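/- For $E\subset\mathbb R^n$ let $\overline{\dim}_A(E)$ denote the (upper) Assouad dimension, i.e. the infimum of all $s\ge 0$ for which there is $C\ge 1$ such that for all $x\in E$ and $0<r<R<\operatorname{diam}(E)$ the set $E\cap B(x,R)$ can be covered by at most $C(r/R)^{-s}$ balls of radius $r$; let $\underline{\dim}_A(E)$ denote the lower Assouad dimension, i.e. the supremum of all $t\ge 0$ for which there is $c>0$ such that for all $x\in E$ and $0<r<R<\operatorname{diam}(E)$ at least $c(r/R)^{-t}$ balls of radius $r$ are needed to cover $E\cap B(x,R)$. (Balls are closed, with arbitrary centers in $\mathbb R^n$.) For an open set $\Omega\subset\mathbb R^n$ write $\Omega^c=\mathbb R^n\setminus\Omega$ and $d_\Omega(x)=\operatorname{dist}(x,\Omega^c)$ (with $d_\Omega\equiv\infty$, $\infty^{\beta-p}=0$ for $\beta<p$, if $\Omega=\mathbb R^n$), and let $\operatorname{Lip}_0(\Omega)$ be the set of Lipschitz functions $u\colon\Omega\to\mathbb R$ with compact support in $\Omega$. Let $1<p<\infty$ and $\beta<p-1$, and let $\Omega_0\subset\mathbb R^n$ be an open set with $\underline{\dim}_A(\Omega_0^c)>n-p+\beta$.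 Let $F\subset\overline{\Omega_0}$ be a closed set with $\overline{\dim}_A(F)<n-p+\beta$, and put $\Omega=\Omega_0\setminus F$. Then there is a constant $C>0$ such that \[ \int_{\Omega}|u(x)|^p\,d_\Omega(x)^{\beta-p}\,dx\le C\int_{\Omega}|\nabla u(x)|^p\,d_\Omega(x)^{\beta}\,dx \] for all $u\in\operatorname{Lip}_0(\Omega_0)$. -/

import Mathlib

open MeasureTheory
open scoped ENNReal NNReal

noncomputable section

/-- The set `T` of centres gives a cover of `A` by closed balls of radius `r`
(the centres may be any points of the space). -/
def CoveredByBalls {X : Type*} [PseudoMetricSpace X] (A : Set X) (r : ℝ) (T : Finset X) : Prop :=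
  A ⊆ ⋃ z ∈ T, Metric.closedBall z r

/-- `s` is admissible for the upper Assouad dimension of `E`: there is `C ≥ 1` such that for all
`x ∈ E` and `0 < r < R < diam E`, the set `E ∩ B(x, R)` can be covered by at most
`C (r / R) ^ (-s)` closed balls of radius `r`. -/
def UpperAssouadExponent {X : Type*} [PseudoMetricSpace X] (E : Set X) (s : ℝ) : Prop :=
  ∃ C : ℝ, 1 ≤ C ∧ ∀ x ∈ E, ∀ r R : ℝ, 0 < r → r < R → ENNReal.ofReal R < Metric.ediam E →
    ∃ T : Finset X, CoveredByBalls (E ∩ Metric.closedBall x R) r T ∧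
      (T.card : ℝ) ≤ C * (r / R) ^ (-s)

/-- `t` is admissible for the lower Assouad dimension of `E`: there is `c > 0` such that for all
`x ∈ E` and `0 < r < R < diam E`, at least `c (r / R) ^ (-t)` closed balls of radius `r` are
needed to cover `E ∩ B(x, R)`. -/
def LowerAssouadExponent {X : Type*} [PseudoMetricSpace X] (E : Set X) (t : ℝ) : Prop :=
  ∃ c : ℝ, 0 < c ∧ ∀ x ∈ E, ∀ r R : ℝ, 0 < r → r < R → ENNReal.ofReal R < Metric.ediam E →
    ∀ T : Finset X, CoveredByBalls (E ∩ Metric.closedBall x R) r T →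
      c * (r / R) ^ (-t) ≤ (T.card : ℝ)

/-- The (upper) Assouad dimension: the infimum of the admissible `s ≥ 0`. -/
def upperAssouadDim {X : Type*} [PseudoMetricSpace X] (E : Set X) : EReal :=
  sInf ((fun s : ℝ => (s : EReal)) '' {s : ℝ | 0 ≤ s ∧ UpperAssouadExponent E s})

/-- The lower Assouad dimension: the supremum of the admissible `t ≥ 0`. -/
def lowerAssouadDim {X : Type*} [PseudoMetricSpace X] (E : Set X) : EReal :=
  sSup ((fun t : ℝ => (t : EReal)) '' {t : ℝ | 0 ≤ t ∧ LowerAssouadExponent E t})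

/-- `Lip₀(Ω)`: functions that are Lipschitz on `Ω` and whose support, the closure of
`{x ∈ Ω | u x ≠ 0}`, is a compact subset of `Ω`. A function on `Ω` is represented by any function
on the whole space that restricts to it; the values outside `Ω` play no role. -/
def LipZero {X : Type*} [PseudoMetricSpace X] (Ω : Set X) : Set (X → ℝ) :=
  {u | (∃ K : ℝ≥0, LipschitzOnWith K u Ω) ∧
    IsCompact (closure {x | x ∈ Ω ∧ u x ≠ 0}) ∧ closure {x | x ∈ Ω ∧ u x ≠ 0} ⊆ Ω}

/-- The `(p, β)`-Hardy inequality in `Ω ⊆ ℝⁿ`, with one constant for all `u` in the class `𝓕`: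
`∫_Ω |u|^p d_Ω^(β-p) dx ≤ C ∫_Ω |∇u|^p d_Ω^β dx`, where `d_Ω(x) = dist(x, Ωᶜ)`.
Both integrals are integrals of `[0, ∞]`-valued functions. -/
def HardyInequalityFor {n : ℕ} (p β : ℝ) (Ω : Set (EuclideanSpace ℝ (Fin n)))
    (𝓕 : Set (EuclideanSpace ℝ (Fin n) → ℝ)) : Prop :=
  ∃ C : ℝ≥0, 0 < C ∧ ∀ u ∈ 𝓕,
    ∫⁻ x in Ω, ‖u x‖ₑ ^ p * Metric.infEDist x Ωᶜ ^ (β - p) ≤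
      (C : ℝ≥0∞) * ∫⁻ x in Ω, ‖gradient u x‖ₑ ^ p * Metric.infEDist x Ωᶜ ^ β

end

/-! The `p`-inequality follows from an `L¹` Hardy inequality with gradient exponent `γ = β - p + 1 <
0`. Write `E` for the complement of `Ω₀` and `d` for the distance to `E ∪ F`. Apply the `L¹`
inequality to `v = |U|^p`, whose gradient is at most `p |U|^(p-1) |∇U|`. Hölder bounds the right
side by `A^(1-1/p) B^(1/p)`, with `A` and `B` the two integrals of the theorem. Since `A` is finite,
its power can be divided out (`exists_hardy_rpow_union`).

The `L¹` inequality splits over the two sets because `d` is the smaller of the two distances and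
both exponents are negative: `d^(γ-1)` is at most the sum of the two separate weights, and each
separate weight with exponent `γ` is at most `d^γ` (`exists_hardy_union`). So `E` and `F` may be
treated independently, with threshold dimension `n - 1 + γ = n - p + β`.

Thin set `F`: `|v|` is dominated by the Riesz potential of `|∇v|`. By Fubini it suffices that the
potential of `d_F^(γ-1)` is at most a multiple of `d_F^γ`, which follows from the smallness of the
neighbourhoods of `F`. No vanishing of `v` on `F` is needed.

Thick set `E`: `v` vanishes on `E`, and `E` carries Frostman-type probability measures of growth
exponent `t > n - 1 + γ` near each of its points (`LowerAssouadExponent.exists_measure`). Averaging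
a Poincaré-type estimate against such a measure bounds `v` by a potential of its gradient over a
ball comparable to the distance to `E`; the adjoint kernel is then integrated
(`exists_setLIntegral_potential_le`). Points farther from `E` than its diameter see `E` as a single
point, which is a thin set. -/

/-! ### Dyadic integration of negative powers in `[0, ∞]` -/

theorem ENNReal.exists_pow_two_near {r x : ℝ≥0∞} (hr0 : r ≠ 0) (hrx : r ≤ x) (hx : x ≠ ∞) :
    ∃ j : ℕ, 2 ^ j * r ≤ x ∧ x ≤ 2 ^ (j + 1) * r := by
  lift x to ℝ≥0 using hx
  have hr : r ≠ ∞ := ne_top_of_le_ne_top ENNReal.coe_ne_top hrx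
  lift r to ℝ≥0 using hr
  have hr0' : 0 < r := pos_iff_ne_zero.2 (by simpa using hr0)
  have hrx' : r ≤ x := by exact_mod_cast hrx
  obtain ⟨j, h1, h2⟩ := exists_nat_pow_near (x := x / r) (y := 2) ((one_le_div hr0').2 hrx')
    (by norm_num)
  refine ⟨j, ?_, ?_⟩
  · exact_mod_cast (le_div_iff₀ hr0').1 h1
  · exact_mod_cast ((div_lt_iff₀ hr0').1 h2).le

theorem ENNReal.rpow_le_rpow_of_nonpos {a b : ℝ≥0∞} {c : ℝ} (hc : c ≤ 0) (hab : a ≤ b) :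
    b ^ c ≤ a ^ c := by
  rw [← neg_neg c, ENNReal.rpow_neg b, ENNReal.rpow_neg a]
  gcongr
  linarith

theorem ENNReal.two_rpow_neg_lt_one {c : ℝ} (hc : c < 0) : (2 : ℝ≥0∞) ^ c < 1 := by
  rw [← ENNReal.rpow_zero (x := 2)]
  exact ENNReal.rpow_lt_rpow_of_exponent_lt (by norm_num) (by norm_num) hc

theorem ENNReal.mul_rpow_of_pow_two (j : ℕ) {r : ℝ≥0∞} (hr0 : r ≠ 0) (c : ℝ) :
    (2 ^ j * r) ^ c = ((2 : ℝ≥0∞) ^ c) ^ j * r ^ c := by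
  rw [ENNReal.mul_rpow_of_ne_zero (by simp) hr0, ← ENNReal.rpow_natCast, ← ENNReal.rpow_natCast,
    ← ENNReal.rpow_mul, ← ENNReal.rpow_mul, mul_comm c]

/-- Integrability of a negative power away from its singularity, from the growth of sublevel
sets. -/
theorem exists_setLIntegral_rpow_neg_ge_le {X : Type*} [MeasurableSpace X] {a b : ℝ} (hb : 0 < b)
    (hab : a < b) :
    ∃ C : ℝ≥0, ∀ (m : Measure X) (f : X → ℝ≥0∞) (A r₀ : ℝ≥0∞), Measurable f → r₀ ≠ 0 → r₀ ≠ ∞ →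
      (∀ r, r₀ ≤ r → r ≠ ∞ → m {x | f x ≤ r} ≤ A * r ^ a) →
      ∫⁻ x in {x | r₀ ≤ f x}, f x ^ (-b) ∂m ≤ C * A * r₀ ^ (a - b) := by
  have hq : (2 : ℝ≥0∞) ^ (a - b) < 1 := ENNReal.two_rpow_neg_lt_one (by linarith)
  have hC : (2 : ℝ≥0∞) ^ a * (1 - 2 ^ (a - b))⁻¹ ≠ ∞ := by
    refine ENNReal.mul_ne_top (ENNReal.rpow_ne_top_of_ne_zero two_ne_zero ENNReal.ofNat_ne_top) ?_
    simpa [tsub_eq_zero_iff_le] using hq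
  refine ⟨((2 : ℝ≥0∞) ^ a * (1 - 2 ^ (a - b))⁻¹).toNNReal, fun m f A r₀ hf h0 ht h ↦ ?_⟩
  rw [ENNReal.coe_toNNReal hC]
  -- On the dyadic shell where `f` is between `2^j r₀` and `2^(j+1) r₀`, the integrand is at most
  -- `(2^j r₀)^(-b)`. Summing the measures of the sublevel sets gives a geometric series of ratio
  -- `2^(a-b) < 1`. Points with `f = ∞` contribute `0` because `b > 0`.
  have key : ∀ x, {x | r₀ ≤ f x}.indicator (fun x ↦ f x ^ (-b)) x ≤
      ∑' j : ℕ, {x | f x ≤ 2 ^ (j + 1) * r₀}.indicator (fun _ ↦ (2 ^ j * r₀) ^ (-b)) x := by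
    intro x
    by_cases hx : r₀ ≤ f x
    · rw [Set.indicator_of_mem (by exact hx)]
      by_cases hxt : f x = ∞
      · simp [hxt, ENNReal.top_rpow_of_neg (neg_lt_zero.2 hb)]
      · obtain ⟨j, h1, h2⟩ := ENNReal.exists_pow_two_near h0 hx hxt
        refine le_trans ?_ (ENNReal.le_tsum j)
        rw [Set.indicator_of_mem (by exact h2), ENNReal.rpow_neg, ENNReal.rpow_neg]
        gcongr
    · rw [Set.indicator_of_notMem (by exact hx)]; exact zero_le
  calc ∫⁻ x in {x | r₀ ≤ f x}, f x ^ (-b) ∂m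
      = ∫⁻ x, {x | r₀ ≤ f x}.indicator (fun x ↦ f x ^ (-b)) x ∂m := by
        rw [lintegral_indicator (measurableSet_le measurable_const hf)]
    _ ≤ ∫⁻ x, ∑' j : ℕ,
          {x | f x ≤ 2 ^ (j + 1) * r₀}.indicator (fun _ ↦ (2 ^ j * r₀) ^ (-b)) x ∂m :=
        lintegral_mono key
    _ = ∑' j : ℕ, (2 ^ j * r₀) ^ (-b) * m {x | f x ≤ 2 ^ (j + 1) * r₀} := by
        rw [lintegral_tsum fun j ↦ (measurable_const.indicator
          (measurableSet_le hf measurable_const)).aemeasurable]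
        simp_rw [lintegral_indicator_const (measurableSet_le hf measurable_const)]
    _ ≤ ∑' j : ℕ, 2 ^ a * A * r₀ ^ (a - b) * (2 ^ (a - b)) ^ j := by
        refine ENNReal.tsum_le_tsum fun j ↦ ?_
        have h1 : r₀ ≤ 2 ^ (j + 1) * r₀ := by
          conv_lhs => rw [← one_mul r₀]
          gcongr
          exact one_le_pow₀ (by norm_num)
        refine (mul_le_mul_right (h _ h1 (ENNReal.mul_ne_top (by simp) ht)) _).trans_eq ?_
        rw [ENNReal.mul_rpow_of_pow_two _ h0, ENNReal.mul_rpow_of_pow_two _ h0,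
          sub_eq_add_neg, ENNReal.rpow_add _ _ h0 ht, ENNReal.rpow_add _ _ (by simp) (by simp)]
        ring
    _ = 2 ^ a * (1 - 2 ^ (a - b))⁻¹ * A * r₀ ^ (a - b) := by
        rw [ENNReal.tsum_mul_left, ENNReal.tsum_geometric]
        ring

/-- Integrability of a negative power near its singularity, from the smallness of sublevel
sets. -/
theorem exists_setLIntegral_rpow_neg_le_le {X : Type*} [MeasurableSpace X] {a b : ℝ} (hb : 0 < b)
    (hab : b < a) :
    ∃ C : ℝ≥0, ∀ (m : Measure X) (f : X → ℝ≥0∞) (A r₀ : ℝ≥0∞), Measurable f → A ≠ ∞ → r₀ ≠ 0 →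
      r₀ ≠ ∞ → (∀ r, r ≠ 0 → r ≤ r₀ → m {x | f x ≤ r} ≤ A * r ^ a) →
      ∫⁻ x in {x | f x ≤ r₀}, f x ^ (-b) ∂m ≤ C * A * r₀ ^ (a - b) := by
  have hq : (2 : ℝ≥0∞) ^ (b - a) < 1 := ENNReal.two_rpow_neg_lt_one (by linarith)
  have hC : (2 : ℝ≥0∞) ^ b * (1 - 2 ^ (b - a))⁻¹ ≠ ∞ := by
    refine ENNReal.mul_ne_top (ENNReal.rpow_ne_top_of_ne_zero two_ne_zero ENNReal.ofNat_ne_top) ?_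
    simpa [tsub_eq_zero_iff_le] using hq
  refine ⟨((2 : ℝ≥0∞) ^ b * (1 - 2 ^ (b - a))⁻¹).toNNReal, fun m f A r₀ hf hA h0 ht h ↦ ?_⟩
  rw [ENNReal.coe_toNNReal hC]
  -- The integrand is `∞` where `f = 0`, and no dyadic shell reaches such points. They form a null
  -- set because `A r^a` tends to `0`; this is where `A ≠ ∞` matters.
  have hzero : ∀ᵐ x ∂m, f x ≠ 0 := by
    have hlim : Filter.Tendsto (fun r : ℝ≥0∞ ↦ A * r ^ a) (nhdsWithin 0 (Set.Ioi 0)) (nhds 0) := by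
      have h1 : Filter.Tendsto (fun r : ℝ≥0∞ ↦ r ^ a) (nhds 0) (nhds 0) := by
        have := (ENNReal.continuous_rpow_const (y := a)).tendsto 0
        rwa [ENNReal.zero_rpow_of_pos (hb.trans hab)] at this
      have h2 := ENNReal.Tendsto.const_mul (a := A) h1 (Or.inr hA)
      rw [mul_zero] at h2
      exact h2.mono_left nhdsWithin_le_nhds
    refine le_antisymm (ge_of_tendsto hlim ?_) zero_le
    filter_upwards [Ioc_mem_nhdsGT (pos_iff_ne_zero.2 h0)] with r hr
    refine (measure_mono fun x hx ↦ ?_).trans (h r hr.1.ne' hr.2)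
    have : f x = 0 := by simpa using hx
    simp [this]
  have hpow : ∀ j : ℕ, (2 ^ j : ℝ≥0∞) ≠ 0 ∧ (2 ^ j : ℝ≥0∞) ≠ ∞ := fun j ↦ by simp
  have key : ∀ x, f x ≠ 0 → {x | f x ≤ r₀}.indicator (fun x ↦ f x ^ (-b)) x ≤
      ∑' j : ℕ, {x | f x ≤ (2 ^ j)⁻¹ * r₀}.indicator
        (fun _ ↦ ((2 ^ (j + 1))⁻¹ * r₀) ^ (-b)) x := by
    intro x hx0
    by_cases hx : f x ≤ r₀
    · rw [Set.indicator_of_mem (by exact hx)]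
      obtain ⟨j, h1, h2⟩ := ENNReal.exists_pow_two_near hx0 hx ht
      refine le_trans ?_ (ENNReal.le_tsum j)
      have h1' : f x ≤ (2 ^ j)⁻¹ * r₀ := by
        rwa [← ENNReal.mul_le_iff_le_inv (hpow j).1 (hpow j).2]
      have h2' : (2 ^ (j + 1))⁻¹ * r₀ ≤ f x := by
        rwa [ENNReal.inv_mul_le_iff (hpow _).1 (hpow _).2]
      rw [Set.indicator_of_mem (by exact h1'), ENNReal.rpow_neg, ENNReal.rpow_neg]
      gcongr
    · rw [Set.indicator_of_notMem (by exact hx)]; exact zero_le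
  have hinv : ∀ (j : ℕ) (c : ℝ), ((2 ^ j : ℝ≥0∞)⁻¹ * r₀) ^ c = ((2 : ℝ≥0∞) ^ (-c)) ^ j * r₀ ^ c := by
    intro j c
    rw [ENNReal.mul_rpow_of_ne_zero (by simp) h0, ENNReal.inv_rpow, ← ENNReal.rpow_natCast,
      ← ENNReal.rpow_natCast, ← ENNReal.rpow_mul, ← ENNReal.rpow_mul, ← ENNReal.rpow_neg]
    ring_nf
  calc ∫⁻ x in {x | f x ≤ r₀}, f x ^ (-b) ∂m
      = ∫⁻ x, {x | f x ≤ r₀}.indicator (fun x ↦ f x ^ (-b)) x ∂m := by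
        rw [lintegral_indicator (measurableSet_le hf measurable_const)]
    _ ≤ ∫⁻ x, ∑' j : ℕ, {x | f x ≤ (2 ^ j)⁻¹ * r₀}.indicator
          (fun _ ↦ ((2 ^ (j + 1))⁻¹ * r₀) ^ (-b)) x ∂m :=
        lintegral_mono_ae (hzero.mono key)
    _ = ∑' j : ℕ, ((2 ^ (j + 1))⁻¹ * r₀) ^ (-b) * m {x | f x ≤ (2 ^ j)⁻¹ * r₀} := by
        rw [lintegral_tsum fun j ↦ (measurable_const.indicator
          (measurableSet_le hf measurable_const)).aemeasurable]
        simp_rw [lintegral_indicator_const (measurableSet_le hf measurable_const)]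
    _ ≤ ∑' j : ℕ, 2 ^ b * A * r₀ ^ (a - b) * (2 ^ (b - a)) ^ j := by
        refine ENNReal.tsum_le_tsum fun j ↦ ?_
        have h1 : (2 ^ j)⁻¹ * r₀ ≤ r₀ := by
          rw [ENNReal.inv_mul_le_iff (hpow j).1 (hpow j).2]
          conv_lhs => rw [← one_mul r₀]
          gcongr
          exact one_le_pow₀ (by norm_num)
        refine (mul_le_mul_right (h _ (mul_ne_zero (by simp) h0) h1) _).trans_eq ?_
        rw [hinv, hinv, sub_eq_add_neg, ENNReal.rpow_add _ _ h0 ht, sub_eq_add_neg,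
          ENNReal.rpow_add _ _ (by simp) (by simp), neg_neg]
        ring
    _ = 2 ^ b * (1 - 2 ^ (b - a))⁻¹ * A * r₀ ^ (a - b) := by
        rw [ENNReal.tsum_mul_left, ENNReal.tsum_geometric]
        ring

/-! ### Oscillation on balls and the Riesz kernel -/

section Riesz

variable {V : Type*} [NormedAddCommGroup V] [NormedSpace ℝ V]

/-- A Lipschitz function is absolutely continuous along the segment, so the fundamental theorem of
calculus applies; almost everywhere differentiability of `v` along the segment identifies the
derivative. -/
theorem LipschitzWith.enorm_sub_le_lintegral_fderiv {v : V → ℝ} {K : ℝ≥0} (hv : LipschitzWith K v)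
    (x y : V) (hd : ∀ᵐ t ∂(volume.restrict (Set.Ioc (0 : ℝ) 1)),
      DifferentiableAt ℝ v (x + t • (y - x))) :
    ‖v x - v y‖ₑ ≤ ∫⁻ t in Set.Ioc (0 : ℝ) 1, ‖fderiv ℝ v (x + t • (y - x))‖ₑ * ‖y - x‖ₑ := by
  set f : ℝ → ℝ := fun t ↦ v (x + t • (y - x))
  have hf : AbsolutelyContinuousOnInterval f 0 1 := by
    have hl : LipschitzWith (K * ‖y - x‖₊) f := by
      refine hv.comp (LipschitzWith.of_dist_le_mul fun s t ↦ ?_)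
      rw [dist_add_left, dist_eq_norm, ← sub_smul, norm_smul, mul_comm]
      simp [Real.dist_eq]
    exact (hl.lipschitzOnWith (s := Set.uIcc 0 1)).absolutelyContinuousOnInterval
  have h1 := hf.integral_deriv_eq_sub
  have h2 : f 1 - f 0 = v y - v x := by simp [f]
  rw [h2, intervalIntegral.integral_of_le zero_le_one] at h1
  rw [← enorm_neg, neg_sub, ← h1]
  refine (enorm_integral_le_lintegral_enorm _).trans (lintegral_mono_ae ?_)
  filter_upwards [hd] with t ht
  have hline : HasDerivAt (fun t : ℝ ↦ x + t • (y - x)) (y - x) t := by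
    simpa using ((hasDerivAt_id t).smul_const (y - x)).const_add x
  have h3 : HasDerivAt f (fderiv ℝ v (x + t • (y - x)) (y - x)) t :=
    ht.hasFDerivAt.comp_hasDerivAt t hline
  rw [h3.deriv]
  exact ContinuousLinearMap.le_opENorm _ _

variable [FiniteDimensional ℝ V] [MeasurableSpace V] [BorelSpace V]
  (μ : Measure V) [μ.IsAddHaarMeasure]

theorem quasiMeasurePreserving_homothety (x : V) {t : ℝ} (ht : t ≠ 0) :
    Measure.QuasiMeasurePreserving (fun y ↦ x + t • (y - x)) μ μ :=
  (measurePreserving_add_left μ x).quasiMeasurePreserving.comp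
    ((Measure.quasiMeasurePreserving_smul μ ht).comp
      (measurePreserving_sub_right μ x).quasiMeasurePreserving)

theorem lintegral_comp_homothety (x : V) {t : ℝ} (ht : 0 < t) {H : V → ℝ≥0∞} (hH : Measurable H) :
    ∫⁻ y, H (x + t • (y - x)) ∂μ =
      ENNReal.ofReal t ^ (-(Module.finrank ℝ V : ℝ)) * ∫⁻ z, H z ∂μ := by
  have h1 : ∫⁻ y, H (x + t • (y - x)) ∂μ = ∫⁻ y, H (x + t • y) ∂μ :=
    lintegral_sub_right_eq_self (fun y ↦ H (x + t • y)) x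
  have h2 : ∫⁻ y, H (x + t • y) ∂μ = ∫⁻ y, H (x + y) ∂(Measure.map (t • ·) μ) := by
    rw [lintegral_map (by fun_prop) (by fun_prop)]
  rw [h1, h2, Measure.map_addHaar_smul μ ht.ne', lintegral_smul_measure, smul_eq_mul,
    lintegral_add_left_eq_self]
  congr 1
  rw [abs_of_nonneg (by positivity), ENNReal.rpow_neg, ENNReal.rpow_natCast,
    ← ENNReal.ofReal_pow ht.le, ENNReal.ofReal_inv_of_pos (by positivity)]

/-- Rademacher's theorem says nothing about one given segment. For fixed `t > 0`, however, the
homothety in `y` pulls null sets back to null sets, and Fubini exchanges the two quantifiers. -/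
theorem ae_ae_differentiableAt_homothety {v : V → ℝ} {K : ℝ≥0} (hv : LipschitzWith K v) (x : V) :
    ∀ᵐ y ∂μ, ∀ᵐ t ∂(volume.restrict (Set.Ioc (0 : ℝ) 1)),
      DifferentiableAt ℝ v (x + t • (y - x)) := by
  have hm : MeasurableSet {q : V × ℝ | DifferentiableAt ℝ v (x + q.2 • (q.1 - x))} :=
    measurableSet_preimage (f := fun q : V × ℝ ↦ x + q.2 • (q.1 - x)) (by fun_prop)
      (measurableSet_of_differentiableAt ℝ v)
  rw [Measure.ae_ae_comm hm]
  refine (ae_restrict_iff' measurableSet_Ioc).2 (.of_forall fun t ht ↦ ?_)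
  exact (quasiMeasurePreserving_homothety μ x ht.1.ne').ae hv.ae_differentiableAt

/-- Integrate the gradient along the segments from `x` to `y`, and substitute `z = x + t (y - x)`
for fixed `t`. The resulting integral of `t^(-n-1)` over `t ≥ |x - z| / (2r)` produces the kernel
`|x - z|^(1-n)`. -/
theorem exists_lintegral_closedBall_enorm_sub_le [Nontrivial V] :
    ∃ C : ℝ≥0, ∀ (v : V → ℝ) (K : ℝ≥0), LipschitzWith K v → ∀ (c x : V) (r : ℝ), 0 < r →
      x ∈ Metric.closedBall c r →
      ∫⁻ y in Metric.closedBall c r, ‖v x - v y‖ₑ ∂μ ≤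
        C * ENNReal.ofReal r ^ (Module.finrank ℝ V : ℝ) * ∫⁻ z in Metric.closedBall c r,
          ‖fderiv ℝ v z‖ₑ * edist x z ^ (1 - (Module.finrank ℝ V : ℝ)) ∂μ := by
  set n : ℝ := (Module.finrank ℝ V : ℝ) with hn
  have hn0 : 0 < n := Nat.cast_pos.2 Module.finrank_pos
  obtain ⟨C, hC⟩ := exists_setLIntegral_rpow_neg_ge_le (X := ℝ) (a := 1) (b := n + 1)
    (by positivity) (by linarith)
  refine ⟨C * 2 ^ n, fun v K hv c x r hr hx ↦ ?_⟩
  set B := Metric.closedBall c r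
  have hB : MeasurableSet B := Metric.isClosed_closedBall.measurableSet
  set g : V → ℝ≥0∞ := fun z ↦ ‖fderiv ℝ v z‖ₑ
  have hg : Measurable g := (measurable_fderiv ℝ v).enorm
  set ρ : ℝ≥0∞ := ENNReal.ofReal (2 * r) with hρ
  have hρ0 : ρ ≠ 0 := by simp [hρ, hr]
  have hρt : ρ ≠ ∞ := ENNReal.ofReal_ne_top
  -- After the substitution `|y - x| = |x - z| / t`, and `|y - x| ≤ 2r = ρ` becomes the constraint
  -- `|x - z| / ρ ≤ t`. Convexity keeps `z` in the ball.
  set H : ℝ → V → ℝ≥0∞ := fun t z ↦ B.indicator g z *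
    ({z | edist x z / ρ ≤ ENNReal.ofReal t}.indicator (fun z ↦ edist x z) z *
      (ENNReal.ofReal t)⁻¹)
  have hHm : Measurable (Function.uncurry H) := by
    refine ((hg.indicator hB).comp measurable_snd).mul (Measurable.mul ?_ (by fun_prop))
    exact Measurable.indicator (f := fun q : ℝ × V ↦ edist x q.2)
      (s := {q : ℝ × V | edist x q.2 / ρ ≤ ENNReal.ofReal q.1}) (by fun_prop)
      (measurableSet_le (by fun_prop) (by fun_prop))
  have hpt : ∀ t ∈ Set.Ioc (0 : ℝ) 1, ∀ y, B.indicator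
      (fun y ↦ g (x + t • (y - x)) * ‖y - x‖ₑ) y ≤ H t (x + t • (y - x)) := by
    intro t ht y
    by_cases hy : y ∈ B
    · have ht0 : ENNReal.ofReal t ≠ 0 := by simpa using ht.1
      have hzB : x + t • (y - x) ∈ B :=
        (convex_closedBall c r).add_smul_sub_mem hx hy ⟨ht.1.le, ht.2⟩
      have hdist : edist x (x + t • (y - x)) = ENNReal.ofReal t * ‖y - x‖ₑ := by
        rw [edist_comm, edist_eq_enorm_sub, add_sub_cancel_left, enorm_smul,
          Real.enorm_of_nonneg ht.1.le]
      have hle : ‖y - x‖ₑ ≤ ρ := by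
        rw [← edist_eq_enorm_sub, edist_dist, hρ]
        refine ENNReal.ofReal_le_ofReal ?_
        have h1 := dist_triangle_right y x c
        have h2 := Metric.mem_closedBall.1 hx
        have h3 := Metric.mem_closedBall.1 hy
        linarith
      have hzs : x + t • (y - x) ∈ {z | edist x z / ρ ≤ ENNReal.ofReal t} := by
        change edist x (x + t • (y - x)) / ρ ≤ ENNReal.ofReal t
        rw [hdist]
        refine ENNReal.div_le_of_le_mul ?_
        gcongr
      simp only [H]
      rw [Set.indicator_of_mem hy, Set.indicator_of_mem hzB, Set.indicator_of_mem hzs, hdist,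
        mul_right_comm (ENNReal.ofReal t), ENNReal.mul_inv_cancel ht0 ENNReal.ofReal_ne_top,
        one_mul]
    · rw [Set.indicator_of_notMem hy]; exact zero_le
  have hinner : ∀ z, (∫⁻ t in Set.Ioc (0 : ℝ) 1, ENNReal.ofReal t ^ (-n) * H t z) ≤
      B.indicator g z * ((C * 2 ^ n : ℝ≥0) * ENNReal.ofReal r ^ n * edist x z ^ (1 - n)) := by
    intro z
    by_cases hz : edist x z = 0
    · simp only [H]
      have : ∀ t, {z | edist x z / ρ ≤ ENNReal.ofReal t}.indicator (fun z ↦ edist x z) z = 0 := by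
        intro t; simp [hz]
      simp [this]
    have hz' : edist x z / ρ ≠ 0 := ENNReal.div_ne_zero.2 ⟨hz, hρt⟩
    have hz'' : edist x z / ρ ≠ ∞ := ENNReal.div_ne_top (edist_ne_top _ _) hρ0
    have h1 := hC (volume.restrict (Set.Ioc (0 : ℝ) 1)) ENNReal.ofReal 1 (edist x z / ρ)
      (by fun_prop) hz' hz'' (fun s _ hs ↦ by
        rw [Measure.restrict_apply (measurableSet_le (by fun_prop) measurable_const)]
        refine (measure_mono (t := Set.Icc 0 s.toReal) fun t ht ↦ ⟨ht.2.1.le, ?_⟩).trans ?_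
        · exact (ENNReal.ofReal_le_iff_le_toReal hs).1 ht.1
        · simp [ENNReal.ofReal_toReal hs])
    have h2 : ∀ t ∈ Set.Ioc (0 : ℝ) 1, ENNReal.ofReal t ^ (-n) * H t z =
        B.indicator g z * edist x z * {t : ℝ | edist x z / ρ ≤ ENNReal.ofReal t}.indicator
          (fun t ↦ ENNReal.ofReal t ^ (-(n + 1))) t := by
      intro t ht
      have ht0 : ENNReal.ofReal t ≠ 0 := by simpa using ht.1
      simp only [H, Set.indicator_apply (s := {z | edist x z / ρ ≤ ENNReal.ofReal t}),
        Set.indicator_apply (s := {t | edist x z / ρ ≤ ENNReal.ofReal t}), Set.mem_ofPred_eq]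
      split_ifs
      · rw [neg_add, ENNReal.rpow_add _ _ ht0 ENNReal.ofReal_ne_top, ENNReal.rpow_neg_one]
        ring
      · simp
    rw [setLIntegral_congr_fun measurableSet_Ioc h2, lintegral_const_mul _
      ((Measurable.pow_const (by fun_prop) _).indicator
        (measurableSet_le measurable_const (by fun_prop))),
      lintegral_indicator (measurableSet_le measurable_const (by fun_prop)), mul_assoc]
    refine mul_le_mul_right ((mul_le_mul_right h1 _).trans_eq ?_) _
    have h3 : (1 : ℝ) - (n + 1) = -n := by ring
    have h4 : ρ ^ n = 2 ^ n * ENNReal.ofReal r ^ n := by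
      rw [hρ, ENNReal.ofReal_mul zero_le_two, ENNReal.mul_rpow_of_nonneg _ _ hn0.le]
      simp
    rw [mul_one, h3, div_eq_mul_inv, ENNReal.mul_rpow_of_ne_top (edist_ne_top _ _)
      (by simpa using hρ0), ENNReal.inv_rpow, ← ENNReal.rpow_neg, neg_neg, h4, sub_eq_add_neg,
      ENNReal.rpow_add _ _ hz (edist_ne_top _ _), ENNReal.rpow_one, ENNReal.coe_mul,
      ENNReal.coe_rpow_of_nonneg _ hn0.le]
    push_cast
    ring
  calc ∫⁻ y in B, ‖v x - v y‖ₑ ∂μ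
      ≤ ∫⁻ y in B, ∫⁻ t in Set.Ioc (0 : ℝ) 1, g (x + t • (y - x)) * ‖y - x‖ₑ ∂volume ∂μ := by
        refine lintegral_mono_ae ?_
        filter_upwards [ae_restrict_of_ae (ae_ae_differentiableAt_homothety μ hv x)] with y hy
        exact hv.enorm_sub_le_lintegral_fderiv x y hy
    _ = ∫⁻ t in Set.Ioc (0 : ℝ) 1, ∫⁻ y in B, g (x + t • (y - x)) * ‖y - x‖ₑ ∂μ := by
        refine lintegral_lintegral_swap (Measurable.aemeasurable ?_)
        exact (hg.comp (by fun_prop : Measurable fun q : V × ℝ ↦ x + q.2 • (q.1 - x))).mul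
          (by fun_prop)
    _ ≤ ∫⁻ t in Set.Ioc (0 : ℝ) 1, ∫⁻ y, H t (x + t • (y - x)) ∂μ := by
        refine setLIntegral_mono' measurableSet_Ioc fun t ht ↦ ?_
        rw [← lintegral_indicator hB]
        exact lintegral_mono (hpt t ht)
    _ = ∫⁻ t in Set.Ioc (0 : ℝ) 1, ∫⁻ z, ENNReal.ofReal t ^ (-n) * H t z ∂μ := by
        refine setLIntegral_congr_fun measurableSet_Ioc fun t ht ↦ ?_
        have hHt : Measurable (H t) := hHm.comp measurable_prodMk_left
        rw [lintegral_comp_homothety μ x ht.1 hHt, lintegral_const_mul _ hHt]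
    _ = ∫⁻ z, ∫⁻ t in Set.Ioc (0 : ℝ) 1, ENNReal.ofReal t ^ (-n) * H t z ∂volume ∂μ := by
        refine lintegral_lintegral_swap (Measurable.aemeasurable ?_)
        exact (Measurable.pow_const (by fun_prop) _).mul hHm
    _ ≤ ∫⁻ z, B.indicator g z *
          ((C * 2 ^ n : ℝ≥0) * ENNReal.ofReal r ^ n * edist x z ^ (1 - n)) ∂μ :=
        lintegral_mono hinner
    _ = ∫⁻ z in B, (C * 2 ^ n : ℝ≥0) * ENNReal.ofReal r ^ n * (g z * edist x z ^ (1 - n)) ∂μ := by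
        rw [← lintegral_indicator hB]
        refine lintegral_congr fun z ↦ ?_
        by_cases hz : z ∈ B
        · rw [Set.indicator_of_mem hz, Set.indicator_of_mem hz]; ring
        · rw [Set.indicator_of_notMem hz, Set.indicator_of_notMem hz, zero_mul]
    _ = _ := by
        exact lintegral_const_mul _ (hg.mul (Measurable.pow_const (by fun_prop) _))

end Riesz

/-! ### Sets of small upper Assouad dimension: coverings and distance integrals -/

/-- For an admissible exponent, the covering bound holds at all scales, without the restriction
to radii smaller than the diameter. -/
theorem UpperAssouadExponent.exists_cover {X : Type*} [PseudoMetricSpace X] [ProperSpace X]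
    {F : Set X} {s : ℝ} (hs : 0 ≤ s) (h : UpperAssouadExponent F s) :
    ∃ C : ℝ, 0 ≤ C ∧ ∀ x ∈ F, ∀ r R : ℝ, 0 < r → r < R →
      ∃ T : Finset X, CoveredByBalls (F ∩ Metric.closedBall x R) r T ∧
        (T.card : ℝ) ≤ C * (R / r) ^ s := by
  obtain ⟨C, hC1, hC⟩ := h
  have hpow : ∀ r R : ℝ, 0 < r → r < R → (1 : ℝ) ≤ (R / r) ^ s := fun r R hr hrR ↦
    Real.one_le_rpow ((one_le_div hr).2 hrR.le) hs
  have hC' : ∀ x ∈ F, ∀ r R : ℝ, 0 < r → r < R → ENNReal.ofReal R < Metric.ediam F →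
      ∃ T : Finset X, CoveredByBalls (F ∩ Metric.closedBall x R) r T ∧
        (T.card : ℝ) ≤ C * (R / r) ^ s := by
    intro x hx r R hr hrR hR
    obtain ⟨T, hT, hcard⟩ := hC x hx r R hr hrR hR
    have hR0 : 0 < R := hr.trans hrR
    refine ⟨T, hT, hcard.trans_eq ?_⟩
    rw [Real.rpow_neg (by positivity), ← Real.inv_rpow (by positivity), inv_div]
  by_cases hbdd : Bornology.IsBounded F
  swap
  · refine ⟨C, by linarith, fun x hx r R hr hrR ↦ hC' x hx r R hr hrR ?_⟩
    rw [Metric.ediam_of_unbounded hbdd]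
    exact ENNReal.ofReal_lt_top
  set D := Metric.diam F with hD
  have hDe : Metric.ediam F = ENNReal.ofReal D :=
    (ENNReal.ofReal_toReal (Metric.isBounded_iff_ediam_ne_top.1 hbdd)).symm
  have hDnn : 0 ≤ D := Metric.diam_nonneg
  -- A bounded `F` is reduced to radii below its diameter `D` by a fixed finite net at scale `D /
  -- 4`: the part of `F` in each net ball lies within `D / 2 < D` of one of its own points, where
  -- the hypothesis applies. The size of the net enters the constant.
  obtain ⟨M, hM⟩ : ∃ T₀ : Finset X, 0 < D → F ⊆ ⋃ z ∈ T₀, Metric.closedBall z (D / 4) := by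
    by_cases hD0 : 0 < D
    · obtain ⟨t, ht, hFt⟩ := Metric.totallyBounded_iff.1
        (hbdd.isCompact_closure.totallyBounded.subset subset_closure) (D / 4) (by linarith)
      refine ⟨ht.toFinset, fun _ ↦ hFt.trans ?_⟩
      simp only [Set.Finite.mem_toFinset]
      exact Set.iUnion₂_mono fun z _ ↦ Metric.ball_subset_closedBall
    · exact ⟨∅, fun h ↦ absurd h hD0⟩
  refine ⟨C * (M.card + 1), by positivity, fun x hx r R hr hrR ↦ ?_⟩
  have hp := hpow r R hr hrR
  have hMC : (M.card : ℝ) + 1 ≤ C * (M.card + 1) * (R / r) ^ s := by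
    have h1 : (M.card : ℝ) + 1 ≤ C * (M.card + 1) := le_mul_of_one_le_left (by positivity) hC1
    exact h1.trans (le_mul_of_one_le_right (by positivity) hp)
  have hsub : ∀ y ∈ F, dist y x ≤ D := fun y hy ↦ Metric.dist_le_diam_of_mem hbdd hy hx
  by_cases hRD : R < D
  · obtain ⟨T, hT, hcard⟩ := hC' x hx r R hr hrR (by
      rw [hDe]; exact (ENNReal.ofReal_lt_ofReal_iff (by linarith)).2 hRD)
    refine ⟨T, hT, hcard.trans ?_⟩
    gcongr
    exact le_mul_of_one_le_right (by linarith) (by linarith [(Nat.cast_nonneg M.card : (0:ℝ) ≤ _)])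
  rw [not_lt] at hRD
  by_cases hrD : D ≤ r
  · refine ⟨{x}, fun y hy ↦ ?_, ?_⟩
    · simpa using (hsub y hy.1).trans hrD
    · have : (0 : ℝ) ≤ M.card := Nat.cast_nonneg _
      simp only [Finset.card_singleton, Nat.cast_one]
      linarith
  rw [not_le] at hrD
  have hM := hM (hr.trans hrD)
  by_cases hr4 : D / 4 ≤ r
  · refine ⟨M, Set.inter_subset_left.trans (hM.trans ?_), by linarith⟩
    exact Set.iUnion₂_mono fun z _ ↦ Metric.closedBall_subset_closedBall hr4
  rw [not_le] at hr4
  have hloc : ∀ z : X, ∃ T : Finset X, CoveredByBalls (F ∩ Metric.closedBall z (D / 4)) r T ∧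
      (T.card : ℝ) ≤ C * (R / r) ^ s := by
    intro z
    rcases (F ∩ Metric.closedBall z (D / 4)).eq_empty_or_nonempty with he | ⟨w, hwF, hwz⟩
    · refine ⟨∅, by simp [CoveredByBalls, he], ?_⟩
      simp only [Finset.card_empty, Nat.cast_zero]
      positivity
    · obtain ⟨T, hT, hcard⟩ := hC' w hwF r (D / 2) hr (by linarith) (by
        rw [hDe]; exact (ENNReal.ofReal_lt_ofReal_iff (by linarith)).2 (by linarith))
      refine ⟨T, Set.Subset.trans ?_ hT, hcard.trans ?_⟩
      · rintro y ⟨hyF, hyz⟩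
        refine ⟨hyF, ?_⟩
        rw [Metric.mem_closedBall] at *
        linarith [dist_triangle_right y w z]
      · gcongr
        linarith
  choose T hT hTc using hloc
  classical
  refine ⟨M.biUnion T, ?_, ?_⟩
  · rintro y ⟨hyF, -⟩
    obtain ⟨z, hz, hyz⟩ := Set.mem_iUnion₂.1 (hM hyF)
    obtain ⟨w, hw, hyw⟩ := Set.mem_iUnion₂.1 (hT z ⟨hyF, hyz⟩)
    exact Set.mem_iUnion₂.2 ⟨w, Finset.mem_biUnion.2 ⟨z, hz, hw⟩, hyw⟩
  · calc ((M.biUnion T).card : ℝ) ≤ ∑ z ∈ M, ((T z).card : ℝ) := by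
          exact_mod_cast Finset.card_biUnion_le
      _ ≤ ∑ z ∈ M, C * (R / r) ^ s := Finset.sum_le_sum fun z _ ↦ hTc z
      _ = C * M.card * (R / r) ^ s := by rw [Finset.sum_const, nsmul_eq_mul]; ring
      _ ≤ C * (M.card + 1) * (R / r) ^ s := by
          gcongr
          linarith

section Thin

variable {V : Type*} [NormedAddCommGroup V] [NormedSpace ℝ V] [FiniteDimensional ℝ V]
  [MeasurableSpace V] [BorelSpace V] (μ : Measure V) [μ.IsAddHaarMeasure]

theorem addHaar_edist_le (y : V) {r : ℝ≥0∞} (hr : r ≠ ∞) :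
    μ {x | edist x y ≤ r} = μ (Metric.ball 0 1) * r ^ (Module.finrank ℝ V : ℝ) := by
  lift r to ℝ≥0 using hr
  have h1 : {x | edist x y ≤ r} = Metric.closedBall y (r : ℝ) := by
    ext x
    rw [Metric.mem_closedBall, ← coe_nndist, NNReal.coe_le_coe, ← edist_le_coe]
    rfl
  rw [h1, Measure.addHaar_closedBall μ y r.coe_nonneg, mul_comm, ENNReal.rpow_natCast,
    ENNReal.ofReal_pow r.coe_nonneg, ENNReal.ofReal_coe_nnreal]

/-- Cover the relevant part of `F` by about `(R / ε)^s` balls of radius `ε`. Their threefold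
enlargements cover the neighbourhood, each having measure of order `ε^n`. -/
theorem UpperAssouadExponent.exists_measure_infEDist_le {F : Set V} {s : ℝ} (hs : 0 ≤ s)
    (h : UpperAssouadExponent F s) :
    ∃ C : ℝ≥0, ∀ (y : V) (R ε : ℝ≥0∞), ε ≠ 0 → ε ≤ R → R ≠ ∞ →
      μ ({x | edist x y ≤ R} ∩ {x | Metric.infEDist x F ≤ ε}) ≤
        C * R ^ s * ε ^ ((Module.finrank ℝ V : ℝ) - s) := by
  set n : ℝ := (Module.finrank ℝ V : ℝ) with hn
  have hn0 : 0 ≤ n := Nat.cast_nonneg _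
  obtain ⟨C, hC0, hC⟩ := h.exists_cover hs
  have hω : μ (Metric.ball (0 : V) 1) ≠ ∞ := measure_ball_lt_top.ne
  refine ⟨(C.toNNReal * 6 ^ s) * ((μ (Metric.ball (0 : V) 1)).toNNReal * 3 ^ n), ?_⟩
  intro y R ε hε0 hεR hR
  have hεt : ε ≠ ∞ := ne_top_of_le_ne_top hR hεR
  -- The distance need not be attained, hence the factor `2`.
  have hnear : ∀ x, Metric.infEDist x F ≤ ε → ∃ f ∈ F, edist x f ≤ 2 * ε := by
    intro x hx
    have : Metric.infEDist x F < 2 * ε := by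
      refine hx.trans_lt ?_
      rw [two_mul]
      exact ENNReal.lt_add_right hεt hε0
    obtain ⟨f, hf, hxf⟩ := Metric.infEDist_lt_iff.1 this
    exact ⟨f, hf, hxf.le⟩
  rcases ({x | edist x y ≤ R} ∩ {x | Metric.infEDist x F ≤ ε}).eq_empty_or_nonempty with
    he | ⟨x₀, hx₀y, hx₀F⟩
  · rw [he, measure_empty]; exact zero_le
  obtain ⟨w, hwF, hxw⟩ := hnear x₀ hx₀F
  lift R to ℝ≥0 using hR
  lift ε to ℝ≥0 using hεt
  have hε0' : 0 < ε := pos_iff_ne_zero.2 (by simpa using hε0)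
  have hεR' : ε ≤ R := by exact_mod_cast hεR
  have hR0 : 0 < R := hε0'.trans_le hεR'
  -- Two steps of length `2ε` between points and `F`, and two of length `R` through `y`, with `ε ≤
  -- R`, stay within `6R` of `w`.
  obtain ⟨T, hT, hcard⟩ := hC w hwF ε (6 * R) hε0' (by
    have : (ε : ℝ) ≤ R := hεR'
    have : (0 : ℝ) < R := hR0
    linarith)
  have hsub : {x | edist x y ≤ R} ∩ {x | Metric.infEDist x F ≤ ε} ⊆
      ⋃ z ∈ T, {x | edist x z ≤ 3 * ε} := by
    rintro x ⟨hxy, hxF⟩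
    obtain ⟨f, hf, hxf⟩ := hnear x hxF
    have hfw : f ∈ Metric.closedBall w (6 * R) := by
      have h1 : edist f w ≤ 2 * ε + R + (R + 2 * ε) := by
        calc edist f w ≤ edist f x + edist x x₀ + edist x₀ w := edist_triangle4 _ _ _ _
          _ ≤ edist f x + (edist x y + edist y x₀) + edist x₀ w := by
              gcongr
              exact edist_triangle _ _ _
          _ ≤ 2 * ε + (R + R) + 2 * ε := by
              rw [edist_comm f x, edist_comm y x₀]
              gcongr
              exacts [hxy, hx₀y]
          _ = _ := by ring
      have h2 : edist f w ≤ ((2 * ε + R + (R + 2 * ε) : ℝ≥0) : ℝ≥0∞) := by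
        push_cast; exact h1
      rw [edist_le_coe] at h2
      rw [Metric.mem_closedBall, ← coe_nndist]
      have h3 : (2 * ε + R + (R + 2 * ε) : ℝ≥0) ≤ 6 * R := by
        calc (2 * ε + R + (R + 2 * ε) : ℝ≥0) ≤ 2 * R + R + (R + 2 * R) := by gcongr
          _ = 6 * R := by ring
      exact_mod_cast h2.trans h3
    obtain ⟨z, hz, hfz⟩ := Set.mem_iUnion₂.1 (hT ⟨hf, hfw⟩)
    refine Set.mem_iUnion₂.2 ⟨z, hz, ?_⟩
    have h4 : edist f z ≤ ε := by
      rw [edist_le_coe]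
      rw [Metric.mem_closedBall, ← coe_nndist] at hfz
      exact_mod_cast hfz
    calc edist x z ≤ edist x f + edist f z := edist_triangle _ _ _
      _ ≤ 2 * ε + ε := by gcongr
      _ = 3 * ε := by ring
  have hcard' : (T.card : ℝ≥0∞) ≤ (C.toNNReal * 6 ^ s : ℝ≥0) * ((R : ℝ≥0∞) ^ s * (ε : ℝ≥0∞) ^ (-s)) := by
    have h1 : (T.card : ℝ≥0) ≤ C.toNNReal * 6 ^ s * (R ^ s * ε ^ (-s)) := by
      rw [← NNReal.coe_le_coe]
      push_cast
      rw [Real.coe_toNNReal _ hC0]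
      refine hcard.trans_eq ?_
      rw [Real.div_rpow (by positivity) (by positivity), Real.mul_rpow (by positivity)
        (by positivity), Real.rpow_neg (by positivity)]
      field_simp
    rw [← ENNReal.coe_rpow_of_nonneg _ hs, ← ENNReal.coe_rpow_of_ne_zero hε0'.ne']
    exact_mod_cast h1
  calc μ ({x | edist x y ≤ R} ∩ {x | Metric.infEDist x F ≤ ε})
      ≤ ∑ z ∈ T, μ {x | edist x z ≤ 3 * ε} := (measure_mono hsub).trans (measure_biUnion_finset_le _ _)
    _ = T.card * (μ (Metric.ball 0 1) * (3 * ε) ^ n) := by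
        rw [Finset.sum_congr rfl fun z _ ↦ addHaar_edist_le μ z (r := 3 * ε)
          (ENNReal.mul_ne_top (by simp) ENNReal.coe_ne_top), Finset.sum_const, nsmul_eq_mul]
    _ ≤ (C.toNNReal * 6 ^ s : ℝ≥0) * ((R : ℝ≥0∞) ^ s * (ε : ℝ≥0∞) ^ (-s)) *
          (μ (Metric.ball 0 1) * (3 * ε) ^ n) := by gcongr
    _ = _ := by
        rw [ENNReal.mul_rpow_of_nonneg _ _ hn0, sub_eq_add_neg,
          ENNReal.rpow_add _ _ hε0 ENNReal.coe_ne_top]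
        push_cast
        rw [ENNReal.coe_toNNReal hω, ENNReal.coe_rpow_of_nonneg _ hn0]
        push_cast
        ring

/-- Negative powers of the distance to a set of small Assouad dimension satisfy the expected
growth bound on balls. -/
theorem UpperAssouadExponent.exists_setLIntegral_infEDist_rpow_le {F : Set V} {s b : ℝ}
    (hs : 0 ≤ s) (h : UpperAssouadExponent F s) (hb : 0 < b)
    (hbs : b < (Module.finrank ℝ V : ℝ) - s) :
    ∃ C : ℝ≥0, ∀ (y : V) (R : ℝ≥0∞), R ≠ 0 → R ≠ ∞ →
      ∫⁻ x in {x | edist x y ≤ R}, Metric.infEDist x F ^ (-b) ∂μ ≤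
        C * R ^ ((Module.finrank ℝ V : ℝ) - b) := by
  set n : ℝ := (Module.finrank ℝ V : ℝ) with hn
  obtain ⟨C₁, hC₁⟩ := h.exists_measure_infEDist_le μ hs
  obtain ⟨C₂, hC₂⟩ := exists_setLIntegral_rpow_neg_le_le (X := V) hb hbs
  have hω : μ (Metric.ball (0 : V) 1) ≠ ∞ := measure_ball_lt_top.ne
  have hf : Measurable fun x : V ↦ Metric.infEDist x F := Metric.continuous_infEDist.measurable
  refine ⟨C₂ * C₁ + (μ (Metric.ball (0 : V) 1)).toNNReal, fun y R hR0 hR ↦ ?_⟩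
  have hball : MeasurableSet {x | edist x y ≤ R} :=
    measurableSet_le (by fun_prop) measurable_const
  have hA : C₁ * R ^ s ≠ ∞ :=
    ENNReal.mul_ne_top ENNReal.coe_ne_top (ENNReal.rpow_ne_top_of_nonneg hs hR)
  have h1 := hC₂ (μ.restrict {x | edist x y ≤ R}) (fun x ↦ Metric.infEDist x F) (C₁ * R ^ s) R hf
    hA hR0 hR fun r hr0 hr ↦ by
      rw [Measure.restrict_apply (measurableSet_le hf measurable_const), Set.inter_comm]
      exact hC₁ y R r hr0 hr hR
  -- Where `d_F ≤ R` the sublevel estimate is integrated dyadically; where `d_F > R` the integrand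
  -- is at most `R^(-b)`.
  rw [← lintegral_add_compl _ (measurableSet_le hf (measurable_const (a := R)))]
  have h2 : ∫⁻ x in {x | Metric.infEDist x F ≤ R}ᶜ, Metric.infEDist x F ^ (-b)
      ∂(μ.restrict {x | edist x y ≤ R}) ≤ R ^ (-b) * (μ (Metric.ball (0 : V) 1) * R ^ n) := by
    calc _ ≤ ∫⁻ x in {x | Metric.infEDist x F ≤ R}ᶜ, R ^ (-b)
            ∂(μ.restrict {x | edist x y ≤ R}) := by
          refine setLIntegral_mono measurable_const fun x hx ↦ ?_
          have hx' : R ≤ Metric.infEDist x F := (lt_of_not_ge fun h ↦ hx h).le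
          rw [ENNReal.rpow_neg, ENNReal.rpow_neg]
          gcongr
      _ ≤ ∫⁻ x, R ^ (-b) ∂(μ.restrict {x | edist x y ≤ R}) := setLIntegral_le_lintegral _ _
      _ = _ := by
          rw [lintegral_const, Measure.restrict_apply_univ, addHaar_edist_le μ y hR]
  refine (add_le_add h1 h2).trans_eq ?_
  rw [ENNReal.coe_add, ENNReal.coe_toNNReal hω, ENNReal.coe_mul, sub_eq_add_neg n b,
    ENNReal.rpow_add _ _ hR0 hR, show n - s - b = -s + n + -b by ring,
    ENNReal.rpow_add _ _ hR0 hR, ENNReal.rpow_add _ _ hR0 hR, ENNReal.rpow_neg _ s]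
  have h3 : R ^ s * (R ^ s)⁻¹ = 1 := ENNReal.mul_inv_cancel
    (ENNReal.rpow_pos (pos_iff_ne_zero.2 hR0) hR).ne' (ENNReal.rpow_ne_top_of_nonneg hs hR)
  calc _ = C₂ * C₁ * (R ^ s * (R ^ s)⁻¹) * (R ^ n * R ^ (-b)) +
        μ (Metric.ball 0 1) * (R ^ n * R ^ (-b)) := by ring
    _ = _ := by rw [h3]; ring

end Thin

/-! ### `L¹` Hardy inequality for thin sets -/

section ThinHardy

variable {V : Type*} [NormedAddCommGroup V] [NormedSpace ℝ V] [FiniteDimensional ℝ V]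
  [MeasurableSpace V] [BorelSpace V] (μ : Measure V) [μ.IsAddHaarMeasure]

/-- A negative power of `d_F` is locally integrable but equals `∞` on `F`. -/
theorem UpperAssouadExponent.measure_eq_zero {F : Set V} {s : ℝ}
    (hs : 0 ≤ s) (h : UpperAssouadExponent F s) (hsn : s < Module.finrank ℝ V) : μ F = 0 := by
  set b := ((Module.finrank ℝ V : ℝ) - s) / 2 with hb
  obtain ⟨C, hC⟩ := h.exists_setLIntegral_infEDist_rpow_le μ hs (b := b) (by linarith)
    (by linarith)
  have hcover : F ⊆ ⋃ k : ℕ, (F ∩ {x | edist x 0 ≤ (k + 1 : ℕ)}) := by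
    intro x hx
    obtain ⟨k, hk⟩ := ENNReal.exists_nat_gt (edist_ne_top x 0)
    refine Set.mem_iUnion.2 ⟨k, hx, hk.le.trans ?_⟩
    push_cast
    exact le_self_add
  refine measure_mono_null hcover (measure_iUnion_null fun k ↦ ?_)
  have hball : MeasurableSet {x : V | edist x 0 ≤ (k + 1 : ℕ)} :=
    measurableSet_le (by fun_prop) measurable_const
  have h1 := hC 0 (k + 1 : ℕ) (by simp) (ENNReal.natCast_ne_top _)
  have h2 := ae_lt_top (μ := μ.restrict {x : V | edist x 0 ≤ (k + 1 : ℕ)})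
    (f := fun x ↦ Metric.infEDist x F ^ (-b))
    (Metric.continuous_infEDist.measurable.pow_const _)
    (ne_top_of_le_ne_top (ENNReal.mul_ne_top ENNReal.coe_ne_top
      (ENNReal.rpow_ne_top_of_nonneg (by linarith) (ENNReal.natCast_ne_top _))) h1)
  rw [ae_restrict_iff' hball] at h2
  refine measure_mono_null ?_ h2
  rintro x ⟨hxF, hxk⟩ hx
  have := hx hxk
  rw [Metric.infEDist_zero_of_mem hxF, ENNReal.zero_rpow_of_neg (by linarith)] at this
  exact absurd this (lt_irrefl _)

/-- Split at distance `δ / 2` from `y`, where `δ = d_F(y)`. Inside, `d_F ≥ δ / 2` and only the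
kernel is integrated. Outside, the measure with density `d_F^(γ-1)` has growth exponent `n - 1 + γ`,
and the kernel exponent `n - 1` exceeds it since `γ < 0`. -/
theorem UpperAssouadExponent.exists_lintegral_infEDist_rpow_mul_edist_rpow_le {F : Set V} {s γ : ℝ}
    (hs : 0 ≤ s) (h : UpperAssouadExponent F s) (hγ : γ < 0)
    (hsγ : s < (Module.finrank ℝ V : ℝ) - 1 + γ) :
    ∃ C : ℝ≥0, ∀ y : V,
      ∫⁻ x, Metric.infEDist x F ^ (γ - 1) * edist x y ^ (1 - (Module.finrank ℝ V : ℝ)) ∂μ ≤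
        C * Metric.infEDist y F ^ γ := by
  set n : ℝ := (Module.finrank ℝ V : ℝ) with hn
  have hω : μ (Metric.ball (0 : V) 1) ≠ ∞ := measure_ball_lt_top.ne
  obtain ⟨C₁, hC₁⟩ := exists_setLIntegral_rpow_neg_le_le (X := V) (a := n) (b := n - 1)
    (by linarith) (by linarith)
  obtain ⟨C₂, hC₂⟩ := h.exists_setLIntegral_infEDist_rpow_le μ hs (b := 1 - γ) (by linarith)
    (by rw [← hn]; linarith)
  obtain ⟨C₃, hC₃⟩ := exists_setLIntegral_rpow_neg_ge_le (X := V) (a := n - (1 - γ)) (b := n - 1)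
    (by linarith) (by linarith)
  have hfm : Measurable fun x : V ↦ Metric.infEDist x F := Metric.continuous_infEDist.measurable
  set D : ℝ≥0∞ := (C₁ * μ (Metric.ball 0 1) + C₃ * C₂) * (2⁻¹) ^ γ with hD
  have hDt : D ≠ ∞ := by
    refine ENNReal.mul_ne_top (ENNReal.add_ne_top.2 ⟨ENNReal.mul_ne_top ENNReal.coe_ne_top hω,
      ENNReal.mul_ne_top ENNReal.coe_ne_top ENNReal.coe_ne_top⟩)
      (ENNReal.rpow_ne_top_of_ne_zero (by simp) (by simp))
  refine ⟨D.toNNReal + 1, fun y ↦ ?_⟩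
  rw [ENNReal.coe_add, ENNReal.coe_toNNReal hDt, ENNReal.coe_one]
  set δ := Metric.infEDist y F with hδ
  rcases F.eq_empty_or_nonempty with rfl | hne
  · simp [ENNReal.top_rpow_of_neg (show γ - 1 < 0 by linarith)]
  have hδt : δ ≠ ∞ := Metric.infEDist_ne_top hne
  by_cases hδ0 : δ = 0
  · rw [hδ0, ENNReal.zero_rpow_of_neg hγ, ENNReal.mul_top (by simp)]
    exact le_top
  set r₀ := 2⁻¹ * δ with hr₀
  have hr0 : r₀ ≠ 0 := mul_ne_zero (by simp) hδ0
  have hrt : r₀ ≠ ∞ := ENNReal.mul_ne_top (by simp) hδt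
  have hadd : r₀ + r₀ = δ := by
    rw [hr₀, ← add_mul, ENNReal.inv_two_add_inv_two, one_mul]
  have hem : Measurable fun x : V ↦ edist x y := by fun_prop
  rw [← lintegral_add_compl _ (measurableSet_le hem (measurable_const (a := r₀)))]
  have hin : ∫⁻ x in {x | edist x y ≤ r₀}, Metric.infEDist x F ^ (γ - 1) * edist x y ^ (1 - n) ∂μ
      ≤ C₁ * μ (Metric.ball 0 1) * r₀ ^ γ := by
    have h1 := hC₁ μ (fun x ↦ edist x y) (μ (Metric.ball 0 1)) r₀ hem hω hr0 hrt
      (fun r _ hr ↦ (addHaar_edist_le μ y (ne_top_of_le_ne_top hrt hr)).le)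
    calc _ ≤ ∫⁻ x in {x | edist x y ≤ r₀}, r₀ ^ (γ - 1) * edist x y ^ (-(n - 1)) ∂μ := by
          refine setLIntegral_mono (by fun_prop) fun x hx ↦ ?_
          have h2 : r₀ ≤ Metric.infEDist x F := by
            have h3 : δ ≤ Metric.infEDist x F + edist y x := Metric.infEDist_le_infEDist_add_edist
            rw [edist_comm, ← hadd] at h3
            have h4 : r₀ + r₀ ≤ Metric.infEDist x F + r₀ := h3.trans (by gcongr; exact hx)
            exact (ENNReal.add_le_add_iff_right hrt).1 h4
          rw [neg_sub, ← neg_sub 1 γ, ENNReal.rpow_neg, ENNReal.rpow_neg]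
          gcongr
          linarith
      _ = r₀ ^ (γ - 1) * ∫⁻ x in {x | edist x y ≤ r₀}, edist x y ^ (-(n - 1)) ∂μ :=
          lintegral_const_mul _ (by fun_prop)
      _ ≤ r₀ ^ (γ - 1) * (C₁ * μ (Metric.ball 0 1) * r₀ ^ (n - (n - 1))) := by gcongr
      _ = _ := by
          rw [show γ = (γ - 1) + (n - (n - 1)) by ring, ENNReal.rpow_add _ _ hr0 hrt]
          ring_nf
  have hout : ∫⁻ x in {x | edist x y ≤ r₀}ᶜ, Metric.infEDist x F ^ (γ - 1) * edist x y ^ (1 - n) ∂μ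
      ≤ C₃ * C₂ * r₀ ^ γ := by
    have h1 := hC₃ (μ.withDensity fun x ↦ Metric.infEDist x F ^ (γ - 1)) (fun x ↦ edist x y) C₂ r₀
      hem hr0 hrt (fun r hr hrt' ↦ by
        rw [withDensity_apply _ (measurableSet_le hem measurable_const)]
        have := hC₂ y r (fun h0 ↦ hr0 (le_antisymm (h0 ▸ hr) zero_le)) hrt'
        rwa [neg_sub] at this)
    have hexp : n - (1 - γ) - (n - 1) = γ := by ring
    rw [restrict_withDensity (measurableSet_le measurable_const hem),
      lintegral_withDensity_eq_lintegral_mul _ (hfm.pow_const _) (hem.pow_const _), hexp,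
      neg_sub] at h1
    exact (lintegral_mono_set fun x hx ↦ (lt_of_not_ge (show ¬ edist x y ≤ r₀ from hx)).le).trans h1
  calc _ ≤ C₁ * μ (Metric.ball 0 1) * r₀ ^ γ + C₃ * C₂ * r₀ ^ γ := add_le_add hin hout
    _ = D * δ ^ γ := by
        rw [hr₀, ENNReal.mul_rpow_of_ne_zero (by simp) hδ0, hD]
        ring
    _ ≤ (D + 1) * δ ^ γ := by gcongr; exact le_self_add

/-- A compactly supported Lipschitz function is dominated by the Riesz potential of its
gradient. -/
theorem exists_enorm_le_lintegral_enorm_fderiv_mul_edist_rpow [Nontrivial V] :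
    ∃ C : ℝ≥0, ∀ (v : V → ℝ) (K : ℝ≥0), LipschitzWith K v → HasCompactSupport v → ∀ x,
      ‖v x‖ₑ ≤ C * ∫⁻ z, ‖fderiv ℝ v z‖ₑ * edist x z ^ (1 - (Module.finrank ℝ V : ℝ)) ∂μ := by
  set n : ℝ := (Module.finrank ℝ V : ℝ) with hn
  have hn1 : 1 ≤ n := by
    have : 1 ≤ Module.finrank ℝ V := Module.finrank_pos
    rw [hn]
    exact_mod_cast this
  have hω : μ (Metric.ball (0 : V) 1) ≠ ∞ := measure_ball_lt_top.ne
  have hω0 : μ (Metric.ball (0 : V) 1) ≠ 0 := (Metric.measure_ball_pos μ 0 one_pos).ne'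
  obtain ⟨C, hC⟩ := exists_lintegral_closedBall_enorm_sub_le μ
  refine ⟨(μ (Metric.ball (0 : V) 1)).toNNReal⁻¹ * (C * 2 ^ n), fun v K hv hvc x ↦ ?_⟩
  obtain ⟨ρ, hρ0, hρ⟩ : ∃ ρ : ℝ, 0 < ρ ∧ tsupport v ⊆ Metric.closedBall x ρ := by
    obtain ⟨ρ, hρ⟩ := (HasCompactSupport.isCompact hvc).isBounded.subset_closedBall x
    exact ⟨max ρ 1, by positivity, hρ.trans (Metric.closedBall_subset_closedBall (le_max_left _ _))⟩
  set I := ∫⁻ z, ‖fderiv ℝ v z‖ₑ * edist x z ^ (1 - n) ∂μ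
  set B := Metric.closedBall x ρ
  set B' := Metric.closedBall x (2 * ρ)
  have hP : 0 < ENNReal.ofReal ρ := by simpa using hρ0
  have h1 := hC v K hv x x (2 * ρ) (by linarith) (Metric.mem_closedBall_self (by linarith))
  have hmB : ∀ R : ℝ, 0 < R → μ (Metric.closedBall x R) =
      μ (Metric.ball 0 1) * ENNReal.ofReal R ^ n := by
    intro R hR
    rw [Measure.addHaar_closedBall μ x hR.le, mul_comm, hn, ENNReal.rpow_natCast,
      ENNReal.ofReal_pow hR.le]
  have h2 : ENNReal.ofReal (2 * ρ) ^ n = 2 ^ n * ENNReal.ofReal ρ ^ n := by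
    rw [ENNReal.ofReal_mul zero_le_two, ENNReal.mul_rpow_of_nonneg _ _ (by linarith)]
    simp
  -- The function vanishes on the annulus between radii `ρ` and `2ρ`, whose measure is at least that
  -- of the inner ball because `2^n ≥ 2`. Averaging the oscillation estimate over it leaves only `|v
  -- x|`.
  have h3 : μ B ≤ μ (B' \ B) := by
    refine le_trans ?_ le_measure_sdiff
    refine ENNReal.le_sub_of_add_le_right ?_ ?_
    · exact measure_closedBall_lt_top.ne
    · rw [hmB ρ hρ0, hmB (2 * ρ) (by linarith), h2, ← two_mul, mul_left_comm]
      gcongr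
      calc (2 : ℝ≥0∞) = 2 ^ (1 : ℝ) := (ENNReal.rpow_one _).symm
        _ ≤ 2 ^ n := ENNReal.rpow_le_rpow_of_exponent_le (by norm_num) hn1
  have h4 : ‖v x‖ₑ * μ B ≤ C * (2 ^ n * ENNReal.ofReal ρ ^ n) * I := by
    calc ‖v x‖ₑ * μ B ≤ ‖v x‖ₑ * μ (B' \ B) := by gcongr
      _ = ∫⁻ y in B' \ B, ‖v x - v y‖ₑ ∂μ := by
          rw [← setLIntegral_const]
          refine setLIntegral_congr_fun (Metric.isClosed_closedBall.measurableSet.diff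
            Metric.isClosed_closedBall.measurableSet) fun y hy ↦ ?_
          have : v y = 0 := image_eq_zero_of_notMem_tsupport fun hy' ↦ hy.2 (hρ hy')
          simp [this]
      _ ≤ ∫⁻ y in B', ‖v x - v y‖ₑ ∂μ := lintegral_mono_set Set.sdiff_subset
      _ ≤ _ := by
          refine h1.trans ?_
          rw [h2]
          gcongr
          exact setLIntegral_le_lintegral _ _
  rw [hmB _ hρ0] at h4
  have hPn0 : ENNReal.ofReal ρ ^ n ≠ 0 := (ENNReal.rpow_pos hP ENNReal.ofReal_ne_top).ne'
  have hPnt : ENNReal.ofReal ρ ^ n ≠ ∞ :=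
    ENNReal.rpow_ne_top_of_nonneg (by linarith) ENNReal.ofReal_ne_top
  have h5 : ‖v x‖ₑ * μ (Metric.ball 0 1) * ENNReal.ofReal ρ ^ n ≤
      C * 2 ^ n * I * ENNReal.ofReal ρ ^ n := by
    calc _ = ‖v x‖ₑ * (μ (Metric.ball 0 1) * ENNReal.ofReal ρ ^ n) := by ring
      _ ≤ _ := h4
      _ = _ := by ring
  rw [ENNReal.mul_le_mul_iff_left hPn0 hPnt] at h5
  rw [ENNReal.coe_mul, ENNReal.coe_inv (by simp [ENNReal.toNNReal_eq_zero_iff, hω, hω0]),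
    ENNReal.coe_toNNReal hω, ENNReal.coe_mul, ENNReal.coe_rpow_of_nonneg _ (by linarith),
    mul_assoc, ← ENNReal.mul_le_iff_le_inv hω0 hω, mul_comm]
  exact_mod_cast h5

/-- The `L¹` Hardy inequality for sets of small Assouad dimension. -/
theorem UpperAssouadExponent.exists_hardy [Nontrivial V] {F : Set V} {s γ : ℝ}
    (hs : 0 ≤ s) (h : UpperAssouadExponent F s) (hγ : γ < 0)
    (hsγ : s < (Module.finrank ℝ V : ℝ) - 1 + γ) :
    ∃ C : ℝ≥0, ∀ (v : V → ℝ) (K : ℝ≥0), LipschitzWith K v → HasCompactSupport v →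
      ∫⁻ x, ‖v x‖ₑ * Metric.infEDist x F ^ (γ - 1) ∂μ ≤
        C * ∫⁻ x, ‖fderiv ℝ v x‖ₑ * Metric.infEDist x F ^ γ ∂μ := by
  set n : ℝ := (Module.finrank ℝ V : ℝ) with hn
  obtain ⟨C₁, hC₁⟩ := h.exists_lintegral_infEDist_rpow_mul_edist_rpow_le μ hs hγ hsγ
  obtain ⟨C₂, hC₂⟩ := exists_enorm_le_lintegral_enorm_fderiv_mul_edist_rpow μ
  refine ⟨C₂ * C₁, fun v K hv hvc ↦ ?_⟩
  have hfm : Measurable fun x : V ↦ Metric.infEDist x F := Metric.continuous_infEDist.measurable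
  have hg : Measurable fun z ↦ ‖fderiv ℝ v z‖ₑ := (measurable_fderiv ℝ v).enorm
  calc ∫⁻ x, ‖v x‖ₑ * Metric.infEDist x F ^ (γ - 1) ∂μ
      ≤ ∫⁻ x, C₂ * ∫⁻ z, ‖fderiv ℝ v z‖ₑ *
          (Metric.infEDist x F ^ (γ - 1) * edist x z ^ (1 - n)) ∂μ ∂μ := by
        refine lintegral_mono fun x ↦ ?_
        calc _ ≤ C₂ * (∫⁻ z, ‖fderiv ℝ v z‖ₑ * edist x z ^ (1 - n) ∂μ) *
              Metric.infEDist x F ^ (γ - 1) := by gcongr; exact hC₂ v K hv hvc x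
          _ = C₂ * ∫⁻ z, (‖fderiv ℝ v z‖ₑ * edist x z ^ (1 - n)) *
              Metric.infEDist x F ^ (γ - 1) ∂μ := by
            rw [lintegral_mul_const _ (by fun_prop), mul_assoc]
          _ = _ := by
            congr 1
            exact lintegral_congr fun z ↦ by ring
    _ = C₂ * ∫⁻ z, ∫⁻ x, ‖fderiv ℝ v z‖ₑ *
          (Metric.infEDist x F ^ (γ - 1) * edist x z ^ (1 - n)) ∂μ ∂μ := by
        have hm : Measurable (Function.uncurry fun x z : V ↦ ‖fderiv ℝ v z‖ₑ *
            (Metric.infEDist x F ^ (γ - 1) * edist x z ^ (1 - n))) :=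
          (hg.comp measurable_snd).mul
            (((hfm.comp measurable_fst).pow_const _).mul (by fun_prop))
        rw [← lintegral_lintegral_swap hm.aemeasurable]
        exact lintegral_const_mul _ hm.lintegral_prod_right'
    _ ≤ C₂ * ∫⁻ z, C₁ * (‖fderiv ℝ v z‖ₑ * Metric.infEDist z F ^ γ) ∂μ := by
        refine mul_le_mul_right (lintegral_mono fun z ↦ ?_) _
        simp only
        rw [lintegral_const_mul _ (by fun_prop), mul_left_comm]
        exact mul_le_mul_right (hC₁ z) _
    _ = _ := by
        rw [lintegral_const_mul _ (by fun_prop), ENNReal.coe_mul, mul_assoc]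

end ThinHardy

/-! ### Frostman measures below the lower Assouad dimension -/

/-- A set that cannot be covered by fewer than `N` balls of radius `r` contains `N` points that are
`r`-separated. -/
theorem exists_separated_of_le_card_cover {X : Type*} [PseudoMetricSpace X] {A : Set X} {r : ℝ}
    (hr : 0 ≤ r) {N : ℕ} (h : ∀ T : Finset X, CoveredByBalls A r T → N ≤ T.card) :
    ∃ T : Finset X, ↑T ⊆ A ∧ T.card = N ∧ ∀ x ∈ T, ∀ y ∈ T, x ≠ y → r < dist x y := by
  classical
  suffices H : ∀ m ≤ N, ∃ T : Finset X, ↑T ⊆ A ∧ T.card = m ∧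
      ∀ x ∈ T, ∀ y ∈ T, x ≠ y → r < dist x y from H N le_rfl
  intro m
  induction m with
  | zero => exact fun _ ↦ ⟨∅, by simp⟩
  | succ m ih =>
    intro hm
    obtain ⟨T, hTA, hTc, hTs⟩ := ih (by omega)
    have hnot : ¬ CoveredByBalls A r T := fun hc ↦ by
      have := h T hc
      omega
    obtain ⟨a, haA, ha⟩ := Set.not_subset.1 hnot
    have hfar : ∀ x ∈ T, r < dist a x := fun x hx ↦ by
      by_contra hle
      exact ha (Set.mem_iUnion₂.2 ⟨x, hx, Metric.mem_closedBall.2 (not_lt.1 hle)⟩)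
    have haT : a ∉ T := fun haT ↦ by
      have := hfar a haT
      rw [dist_self] at this
      linarith
    refine ⟨insert a T, ?_, by rw [Finset.card_insert_of_notMem haT, hTc], ?_⟩
    · rw [Finset.coe_insert]
      exact Set.insert_subset haA hTA
    · intro x hx y hy hxy
      rcases Finset.mem_insert.1 hx with rfl | hxT <;> rcases Finset.mem_insert.1 hy with rfl | hyT
      · exact absurd rfl hxy
      · exact hfar y hyT
      · rw [dist_comm]; exact hfar x hxT
      · exact hTs x hxT y hyT hxy

/-- A discrete Frostman lemma: below the lower Assouad dimension there are probability measures
with the expected growth bound, at all scales above a prescribed one. -/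
theorem LowerAssouadExponent.exists_measure {X : Type*} [PseudoMetricSpace X] [MeasurableSpace X]
    [MeasurableSingletonClass X] {E : Set X} {t t₀ : ℝ} (ht : 0 ≤ t) (htt : t < t₀)
    (h : LowerAssouadExponent E t₀) :
    ∃ C : ℝ≥0, ∀ y ∈ E, ∀ ρ : ℝ, 0 < ρ → ENNReal.ofReal ρ < Metric.ediam E → ∀ η : ℝ, 0 < η →
      ∃ m : Measure X, IsProbabilityMeasure m ∧ (∀ᵐ w ∂m, w ∈ E ∧ dist w y ≤ ρ) ∧
        ∀ z r, η ≤ r → m (Metric.closedBall z r) ≤ C * ENNReal.ofReal (r / ρ) ^ t := by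
  obtain ⟨c, hc0, hc⟩ := h
  set q : ℝ := c * 8 ^ (-t₀) with hq
  have hq0 : 0 < q := by positivity
  -- The ratio `l` between generations is small enough that `B(y, ρ/2) ∩ E` contains at least
  -- `l^(-t)` points separated by `4lρ`. The quotient of these radii is `8l`, whence the `8` in `q`;
  -- the gap `t < t₀` absorbs `c`.
  obtain ⟨l, hl0, hl16, hlq⟩ : ∃ l : ℝ, 0 < l ∧ l ≤ 1 / 16 ∧ l ^ (t₀ - t) ≤ q := by
    refine ⟨min (1 / 16) (q ^ (t₀ - t)⁻¹), by positivity, min_le_left _ _, ?_⟩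
    calc _ ≤ (q ^ (t₀ - t)⁻¹) ^ (t₀ - t) :=
          Real.rpow_le_rpow (by positivity) (min_le_right _ _) (by linarith)
      _ = q := Real.rpow_inv_rpow hq0.le (by linarith)
  have hlt : l ^ (-t) ≤ c * (8 * l) ^ (-t₀) := by
    rw [Real.mul_rpow (by norm_num) hl0.le, ← mul_assoc, ← hq]
    calc l ^ (-t) = l ^ (t₀ - t) * l ^ (-t₀) := by rw [← Real.rpow_add hl0]; ring_nf
      _ ≤ q * l ^ (-t₀) := by gcongr
  set N : ℕ := ⌈l ^ (-t)⌉₊ with hN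
  have hNl : l ^ (-t) ≤ N := Nat.le_ceil _
  have hN0 : 0 < N := Nat.ceil_pos.2 (by positivity)
  set C : ℝ≥0 := (l ^ (-t)).toNNReal with hC
  have hCpos : 0 ≤ l ^ (-t) := by positivity
  have hone : ∀ r ρ : ℝ, 0 < ρ → l * ρ ≤ r → (1 : ℝ≥0∞) ≤ C * ENNReal.ofReal (r / ρ) ^ t := by
    intro r ρ hρ hr
    have h1 : ENNReal.ofReal l ≤ ENNReal.ofReal (r / ρ) :=
      ENNReal.ofReal_le_ofReal ((le_div_iff₀ hρ).2 hr)
    calc (1 : ℝ≥0∞) = C * ENNReal.ofReal l ^ t := by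
          rw [hC, ← ENNReal.ofReal, ENNReal.ofReal_rpow_of_pos hl0, ← ENNReal.ofReal_mul hCpos,
            ← Real.rpow_add hl0]
          simp
      _ ≤ _ := by gcongr
  -- Generation `k` controls radii down to `l^k ρ`. It starts from a Dirac mass, and each new
  -- generation averages `N` copies centred at separated points of `E`. Radii at least `lρ` are
  -- trivial because `C l^t = 1`.
  have main : ∀ k : ℕ, ∀ y ∈ E, ∀ ρ : ℝ, 0 < ρ → ENNReal.ofReal ρ < Metric.ediam E →
      ∃ m : Measure X, IsProbabilityMeasure m ∧ (∀ᵐ w ∂m, w ∈ E ∧ dist w y ≤ ρ) ∧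
        ∀ z r, l ^ k * ρ ≤ r → m (Metric.closedBall z r) ≤ C * ENNReal.ofReal (r / ρ) ^ t := by
    intro k
    induction k with
    | zero =>
      intro y hy ρ hρ _
      refine ⟨Measure.dirac y, inferInstance, ?_, fun z r hr ↦ ?_⟩
      · rw [ae_dirac_eq]
        exact ⟨hy, by simpa using hρ.le⟩
      · exact prob_le_one.trans (hone r ρ hρ (by nlinarith))
    | succ k ih =>
      intro y hy ρ hρ hρE
      have hlρ : 0 < l * ρ := by positivity
      have hlρ16 : l * ρ ≤ ρ / 16 := by nlinarith
      obtain ⟨T, hTE, hTc, hTs⟩ := exists_separated_of_le_card_cover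
        (A := E ∩ Metric.closedBall y (ρ / 2)) (r := 4 * (l * ρ)) (N := N) (by positivity) (by
          intro T hT
          have h1 := hc y hy (4 * (l * ρ)) (ρ / 2) (by positivity) (by linarith)
            ((ENNReal.ofReal_le_ofReal (by linarith)).trans_lt hρE) T hT
          rw [show 4 * (l * ρ) / (ρ / 2) = 8 * l by field_simp; norm_num] at h1
          exact Nat.ceil_le.2 (hlt.trans h1))
      have ih' : ∀ x : X, ∃ m : Measure X, x ∈ E → IsProbabilityMeasure m ∧
          (∀ᵐ w ∂m, w ∈ E ∧ dist w x ≤ l * ρ) ∧ ∀ z r, l ^ k * (l * ρ) ≤ r →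
            m (Metric.closedBall z r) ≤ C * ENNReal.ofReal (r / (l * ρ)) ^ t := by
        intro x
        by_cases hx : x ∈ E
        · obtain ⟨m, hm⟩ := ih x hx (l * ρ) hlρ
            ((ENNReal.ofReal_le_ofReal (by linarith)).trans_lt hρE)
          exact ⟨m, fun _ ↦ hm⟩
        · exact ⟨0, fun hx' ↦ absurd hx' hx⟩
      choose m hm using ih'
      have hNe : (N : ℝ≥0∞) ≠ 0 := by exact_mod_cast hN0.ne'
      have hNt : (N : ℝ≥0∞) ≠ ∞ := ENNReal.natCast_ne_top _
      set M : Measure X := (N : ℝ≥0∞)⁻¹ • ∑ i ∈ T, m i with hM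
      have hMs : ∀ s, M s = (N : ℝ≥0∞)⁻¹ * ∑ i ∈ T, m i s := fun s ↦ by
        rw [hM, Measure.smul_apply, Measure.finsetSum_apply, smul_eq_mul]
      have hMprob : IsProbabilityMeasure M := by
        refine ⟨?_⟩
        rw [hMs, Finset.sum_congr rfl fun i hi ↦ (hm i (hTE hi).1).1.measure_univ]
        rw [Finset.sum_const, hTc, nsmul_eq_mul, mul_one, ENNReal.inv_mul_cancel hNe hNt]
      refine ⟨M, hMprob, ?_, fun z r hr ↦ ?_⟩
      · rw [ae_iff, hMs, Finset.sum_eq_zero, mul_zero]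
        intro i hi
        rw [← ae_iff]
        filter_upwards [(hm i (hTE hi).1).2.1] with w hw
        refine ⟨hw.1, ?_⟩
        have h1 := Metric.mem_closedBall.1 (hTE hi).2
        linarith [dist_triangle w i y, hw.2]
      · by_cases hrl : l * ρ ≤ r
        · exact prob_le_one.trans (hone r ρ hρ hrl)
        rw [not_le] at hrl
        have hr' : l ^ k * (l * ρ) ≤ r := by rwa [← mul_assoc, ← pow_succ]
        have hr0 : 0 < r := lt_of_lt_of_le (by positivity) hr
        have hmeet : ∀ i ∈ T, m i (Metric.closedBall z r) ≠ 0 → dist i z ≤ l * ρ + r := by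
          intro i hi hne
          by_contra hlt'
          refine hne ?_
          have h1 := ae_iff.1 (hm i (hTE hi).1).2.1
          refine measure_mono_null ?_ h1
          intro w hw hw'
          refine hlt' ?_
          have h2 := Metric.mem_closedBall.1 hw
          linarith [dist_triangle_left i z w, hw'.2]
        -- For `r < lρ` the ball charges at most one child: two charged centres would be within
        -- `2(lρ + r) < 4lρ` of each other.
        have hsum : ∑ i ∈ T, m i (Metric.closedBall z r) ≤
            C * ENNReal.ofReal (r / (l * ρ)) ^ t := by
          by_cases hall : ∀ i ∈ T, m i (Metric.closedBall z r) = 0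
          · rw [Finset.sum_eq_zero hall]; exact zero_le
          · push Not at hall
            obtain ⟨i, hi, hne⟩ := hall
            rw [Finset.sum_eq_single_of_mem i hi]
            · exact (hm i (hTE hi).1).2.2 z r hr'
            · intro j hj hji
              by_contra hne'
              have h1 := hTs j hj i hi hji
              have h2 := hmeet i hi hne
              have h3 := hmeet j hj hne'
              linarith [dist_triangle_right j i z]
        rw [hMs]
        -- Rescaling costs the factor `l^(-t) = C`, and averaging gains `1 / N` with `N ≥ l^(-t)`.
        -- The same `C` therefore serves all generations.
        calc _ ≤ (N : ℝ≥0∞)⁻¹ * (C * ENNReal.ofReal (r / (l * ρ)) ^ t) := by gcongr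
          _ = (N : ℝ≥0∞)⁻¹ * C * (C * ENNReal.ofReal (r / ρ) ^ t) := by
              have h1 : r / (l * ρ) = l⁻¹ * (r / ρ) := by field_simp
              rw [h1, ENNReal.ofReal_mul (by positivity), ENNReal.mul_rpow_of_nonneg _ _ ht,
                ENNReal.ofReal_rpow_of_pos (inv_pos.2 hl0), Real.inv_rpow hl0.le,
                ← Real.rpow_neg hl0.le]
              change _ = (N : ℝ≥0∞)⁻¹ * ENNReal.ofReal (l ^ (-t)) * _
              ring
          _ ≤ 1 * (C * ENNReal.ofReal (r / ρ) ^ t) := by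
              gcongr
              rw [ENNReal.inv_mul_le_iff hNe hNt, mul_one]
              change ENNReal.ofReal (l ^ (-t)) ≤ _
              exact ENNReal.ofReal_le_of_le_toReal (by simpa using hNl)
          _ = _ := one_mul _
  refine ⟨C, fun y hy ρ hρ hρE η hη ↦ ?_⟩
  obtain ⟨k, hk⟩ := exists_pow_lt_of_lt_one (div_pos hη hρ) (by linarith : l < 1)
  obtain ⟨m, hm1, hm2, hm3⟩ := main k y hy ρ hρ hρE
  exact ⟨m, hm1, hm2, fun z r hr ↦ hm3 z r (((lt_div_iff₀ hρ).1 hk).le.trans hr)⟩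

/-- The measure lives on `E`, so all distances to `z` are at least `d_E(z) ≥ η`. Growth at scales
above `η` is enough for the dyadic integration. -/
theorem LowerAssouadExponent.exists_measure_lintegral_edist_rpow_le {X : Type*}
    [PseudoMetricSpace X] [MeasurableSpace X] [OpensMeasurableSpace X] [MeasurableSingletonClass X]
    {E : Set X} {t t₀ b : ℝ} (ht : 0 ≤ t) (htt : t < t₀) (htb : t < b)
    (h : LowerAssouadExponent E t₀) :
    ∃ C : ℝ≥0, ∀ y ∈ E, ∀ ρ : ℝ, 0 < ρ → ENNReal.ofReal ρ < Metric.ediam E → ∀ η : ℝ≥0, 0 < η →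
      ∃ m : Measure X, IsProbabilityMeasure m ∧ (∀ᵐ w ∂m, w ∈ E ∧ dist w y ≤ ρ) ∧
        ∀ z, η ≤ Metric.infEDist z E → ∫⁻ w, edist w z ^ (-b) ∂m ≤
          C * ENNReal.ofReal ρ ^ (-t) * Metric.infEDist z E ^ (t - b) := by
  obtain ⟨C₁, hC₁⟩ := h.exists_measure ht htt
  obtain ⟨C₂, hC₂⟩ := exists_setLIntegral_rpow_neg_ge_le (X := X) (ht.trans_lt htb) htb
  refine ⟨C₂ * C₁, fun y hy ρ hρ hρE η hη ↦ ?_⟩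
  obtain ⟨m, hm1, hm2, hm3⟩ := hC₁ y hy ρ hρ hρE η hη
  refine ⟨m, hm1, hm2, fun z hz ↦ ?_⟩
  have hm : Measurable fun w ↦ edist w z := (continuous_id.edist continuous_const).measurable
  have h1 := hC₂ m (fun w ↦ edist w z) (C₁ * ENNReal.ofReal ρ ^ (-t)) (Metric.infEDist z E) hm
    (fun h0 ↦ by rw [h0] at hz; simp [hη.ne'] at hz) (Metric.infEDist_ne_top ⟨y, hy⟩)
    fun r hr hrt ↦ by
      lift r to ℝ≥0 using hrt
      have hηr : (η : ℝ) ≤ r := by exact_mod_cast hz.trans hr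
      have h2 := hm3 z r hηr
      have h3 : {w | edist w z ≤ r} = Metric.closedBall z (r : ℝ) := by
        ext w
        rw [Metric.mem_closedBall, ← coe_nndist, NNReal.coe_le_coe, ← edist_le_coe]
        rfl
      rw [h3]
      refine h2.trans_eq ?_
      rw [ENNReal.ofReal_div_of_pos hρ, div_eq_mul_inv, ENNReal.mul_rpow_of_nonneg _ _ ht,
        ENNReal.inv_rpow, ← ENNReal.rpow_neg, ENNReal.ofReal_coe_nnreal]
      ring
  have h4 : m.restrict {w | Metric.infEDist z E ≤ edist w z} = m := by
    refine Measure.restrict_eq_self_of_ae_mem ?_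
    filter_upwards [hm2] with w hw
    rw [edist_comm]
    exact Metric.infEDist_le_edist_of_mem hw.1
  rw [h4] at h1
  refine h1.trans_eq ?_
  push_cast
  ring

/-! ### Pointwise potential bounds near a thick set -/

section Thick

variable {V : Type*} [NormedAddCommGroup V] [NormedSpace ℝ V] [FiniteDimensional ℝ V]
  [MeasurableSpace V] [BorelSpace V] (μ : Measure V) [μ.IsAddHaarMeasure]

/-- Pointwise bound by a potential of the gradient for functions that vanish on a set of large
lower Assouad dimension. -/
theorem LowerAssouadExponent.exists_enorm_le [Nontrivial V] {E : Set V} {t t₀ : ℝ}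
    (hE : IsClosed E) (ht : 0 ≤ t) (htt : t < t₀) (htn : t < (Module.finrank ℝ V : ℝ) - 1)
    (h : LowerAssouadExponent E t₀) :
    ∃ C : ℝ≥0, ∀ (v : V → ℝ) (K : ℝ≥0), LipschitzWith K v → HasCompactSupport v →
      Disjoint (tsupport v) E → ∀ x, Metric.infEDist x E < Metric.ediam E →
      ‖v x‖ₑ ≤ C * ∫⁻ z in {z | edist x z ≤ 2 * Metric.infEDist x E}, ‖fderiv ℝ v z‖ₑ *
        (edist x z ^ (1 - (Module.finrank ℝ V : ℝ)) + Metric.infEDist x E ^ (-t) *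
          Metric.infEDist z E ^ (t + 1 - (Module.finrank ℝ V : ℝ))) ∂μ := by
  set n : ℝ := (Module.finrank ℝ V : ℝ) with hn
  have hω : μ (Metric.ball (0 : V) 1) ≠ ∞ := measure_ball_lt_top.ne
  have hω0 : μ (Metric.ball (0 : V) 1) ≠ 0 := (Metric.measure_ball_pos μ 0 one_pos).ne'
  obtain ⟨C₁, hC₁⟩ := exists_lintegral_closedBall_enorm_sub_le μ
  obtain ⟨C₂, hC₂⟩ := h.exists_measure_lintegral_edist_rpow_le (b := n - 1) ht htt htn
  refine ⟨(μ (Metric.ball (0 : V) 1)).toNNReal⁻¹ * (C₁ * (C₂ + 1)), ?_⟩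
  intro v K hv hvc hvE x hxE
  have hzero : ∀ w ∈ E, v w = 0 := fun w hw ↦
    image_eq_zero_of_notMem_tsupport fun hw' ↦ Set.disjoint_left.1 hvE hw' hw
  by_cases hx : x ∈ E
  · simp [hzero x hx]
  have hne : E.Nonempty := by
    rw [Set.nonempty_iff_ne_empty]
    rintro rfl
    simp at hxE
  obtain ⟨y, hy, hxy⟩ := hE.exists_infDist_eq_dist hne x
  set δ := Metric.infDist x E with hδ
  have hδ0 : 0 < δ := (hE.notMem_iff_infDist_pos hne).1 hx
  have hδe : Metric.infEDist x E = ENNReal.ofReal δ :=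
    (ENNReal.ofReal_toReal (Metric.infEDist_ne_top hne)).symm
  rw [hδe] at hxE
  -- The gradient vanishes within `η` of `E`, so a Frostman measure that is controlled only above
  -- scale `η` suffices, and its constant does not depend on `η`.
  obtain ⟨η, hη0, hη⟩ := Metric.exists_pos_forall_lt_edist hvc.isCompact hE hvE
  have hη' : ∀ z, fderiv ℝ v z ≠ 0 → η ≤ Metric.infEDist z E := fun z hz ↦
    Metric.le_infEDist.2 fun w hw ↦ (hη z (support_fderiv_subset ℝ hz) w hw).le
  obtain ⟨m, hm, hmE, hmI⟩ := hC₂ y hy δ hδ0 hxE η hη0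
  set g : V → ℝ≥0∞ := fun z ↦ ‖fderiv ℝ v z‖ₑ
  have hg : Measurable g := (measurable_fderiv ℝ v).enorm
  set B := Metric.closedBall x (2 * δ) with hB
  have hBm : MeasurableSet B := Metric.isClosed_closedBall.measurableSet
  have hBeq : {z | edist x z ≤ 2 * Metric.infEDist x E} = B := by
    ext z
    rw [hδe, hB, Metric.mem_closedBall, dist_comm, ← ENNReal.ofReal_le_ofReal_iff (by linarith),
      ← edist_dist, ENNReal.ofReal_mul zero_le_two]
    simp
  have hP : ∀ w ∈ B, ∫⁻ a in B, ‖v w - v a‖ₑ ∂μ ≤ C₁ * ENNReal.ofReal (2 * δ) ^ n *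
      ∫⁻ z in B, g z * edist w z ^ (1 - n) ∂μ := fun w hw ↦
    hC₁ v K hv x w (2 * δ) (by linarith) hw
  set P := ENNReal.ofReal (2 * δ) ^ n with hPdef
  have hvm : Measurable fun a ↦ ‖v a‖ₑ := hv.continuous.measurable.enorm
  -- Every `w ∈ E` within `δ` of the nearest point `y` lies in `B` and has `v w = 0`, so the
  -- oscillation estimate at `w` bounds the integral of `|v|`. Averaging over `m` replaces the
  -- singular kernel at `w` by a power of the distance to `E`.
  have h1 : ∫⁻ a in B, ‖v a‖ₑ ∂μ ≤ C₁ * P *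
      ∫⁻ z in B, g z * (C₂ * (Metric.infEDist x E ^ (-t) *
        Metric.infEDist z E ^ (t + 1 - n))) ∂μ := by
    calc ∫⁻ a in B, ‖v a‖ₑ ∂μ = ∫⁻ w, ∫⁻ a in B, ‖v a‖ₑ ∂μ ∂m := by simp
      _ ≤ ∫⁻ w, C₁ * P * ∫⁻ z in B, g z * edist w z ^ (1 - n) ∂μ ∂m := by
          refine lintegral_mono_ae ?_
          filter_upwards [hmE] with w hw
          have hwB : w ∈ B := by
            rw [hB, Metric.mem_closedBall]
            linarith [dist_triangle w y x, dist_comm x y, hw.2]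
          simpa [hzero w hw.1] using hP w hwB
      _ = C₁ * P * ∫⁻ z in B, ∫⁻ w, g z * edist w z ^ (1 - n) ∂m ∂μ := by
          have hmeas : Measurable (Function.uncurry fun w z : V ↦ g z * edist w z ^ (1 - n)) :=
            (hg.comp measurable_snd).mul (by fun_prop)
          rw [← lintegral_lintegral_swap hmeas.aemeasurable]
          exact lintegral_const_mul _ hmeas.lintegral_prod_right'
      _ ≤ _ := by
          refine mul_le_mul_right (lintegral_mono fun z ↦ ?_) _
          by_cases hz : fderiv ℝ v z = 0
          · have hgz : g z = 0 := by simp only [g, hz]; exact enorm_zero (E := V →L[ℝ] ℝ)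
            simp [hgz]
          rw [lintegral_const_mul _ (by fun_prop)]
          refine mul_le_mul_right ?_ _
          have h2 := hmI z (hη' z hz)
          rwa [neg_sub, ← hδe, mul_assoc, show t - (n - 1) = t + 1 - n by ring] at h2
  have h3 : ‖v x‖ₑ * μ B ≤ C₁ * P * ∫⁻ z in B, g z * edist x z ^ (1 - n) ∂μ +
      ∫⁻ a in B, ‖v a‖ₑ ∂μ := by
    calc ‖v x‖ₑ * μ B = ∫⁻ a in B, ‖v x‖ₑ ∂μ := (setLIntegral_const _ _).symm
      _ ≤ ∫⁻ a in B, (‖v x - v a‖ₑ + ‖v a‖ₑ) ∂μ := lintegral_mono fun a ↦ by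
          simpa using enorm_add_le (v x - v a) (v a)
      _ = ∫⁻ a in B, ‖v x - v a‖ₑ ∂μ + ∫⁻ a in B, ‖v a‖ₑ ∂μ := lintegral_add_right _ hvm
      _ ≤ _ := by
          gcongr
          exact hP x (Metric.mem_closedBall_self (by linarith))
  set J := ∫⁻ z in {z | edist x z ≤ 2 * Metric.infEDist x E}, g z *
        (edist x z ^ (1 - n) + Metric.infEDist x E ^ (-t) *
          Metric.infEDist z E ^ (t + 1 - n)) ∂μ with hJ
  have h4 : ‖v x‖ₑ * μ B ≤ C₁ * P * ((C₂ + 1) * J) := by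
    refine (h3.trans (add_le_add_right h1 _)).trans ?_
    have hJ' : (C₂ + 1) * J = ∫⁻ z in B, (C₂ + 1) * (g z * (edist x z ^ (1 - n) +
        Metric.infEDist x E ^ (-t) * Metric.infEDist z E ^ (t + 1 - n))) ∂μ := by
      rw [hJ, hBeq, lintegral_const_mul' _ _ (by simp)]
    rw [← mul_add, ← lintegral_add_left (by fun_prop), hJ']
    refine mul_le_mul_right (lintegral_mono fun z ↦ ?_) _
    simp only
    set a := edist x z ^ (1 - n)
    set b := Metric.infEDist x E ^ (-t) * Metric.infEDist z E ^ (t + 1 - n)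
    calc g z * a + g z * (C₂ * b) ≤ g z * a + g z * (C₂ * b) + g z * (C₂ * a + b) := le_self_add
      _ = _ := by ring
  have hμB : μ B = μ (Metric.ball 0 1) * P := by
    rw [hB, Measure.addHaar_closedBall μ x (by linarith), mul_comm, hPdef, hn,
      ENNReal.rpow_natCast, ENNReal.ofReal_pow (by linarith)]
  have hP0 : P ≠ 0 := (ENNReal.rpow_pos (by simpa using hδ0) ENNReal.ofReal_ne_top).ne'
  have hPt : P ≠ ∞ := ENNReal.rpow_ne_top_of_nonneg (by linarith) ENNReal.ofReal_ne_top
  have h5 : ‖v x‖ₑ * μ (Metric.ball 0 1) * P ≤ C₁ * (C₂ + 1) * J * P := by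
    calc _ = ‖v x‖ₑ * (μ (Metric.ball 0 1) * P) := by ring
      _ ≤ _ := hμB ▸ h4
      _ = _ := by ring
  rw [ENNReal.mul_le_mul_iff_left hP0 hPt] at h5
  rw [ENNReal.coe_mul, ENNReal.coe_inv (by simp [ENNReal.toNNReal_eq_zero_iff, hω, hω0]),
    ENNReal.coe_toNNReal hω, ENNReal.coe_mul,
    mul_assoc, ← ENNReal.mul_le_iff_le_inv hω0 hω, mul_comm]
  exact_mod_cast h5

/-- This is the adjoint estimate needed after Fubini. On the domain, `d_E(x)` is at least `d_E(z) /
3` and at least `|x - z| / 2`; use the first where `|x - z| ≤ d_E(z)` and the second beyond. There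
the two decay exponents `n - γ` and `1 + t - γ` both exceed `n`, by `γ < 0` and `t > n - 1 + γ`. -/
theorem exists_setLIntegral_potential_le {γ t : ℝ} (hn1 : 1 < (Module.finrank ℝ V : ℝ))
    (hγ : γ < 0) (ht : 0 ≤ t) (htγ : (Module.finrank ℝ V : ℝ) - 1 + γ < t) :
    ∃ C : ℝ≥0, ∀ (E : Set V), E.Nonempty → ∀ z : V,
      ∫⁻ x in {x | edist x z ≤ 2 * Metric.infEDist x E}, Metric.infEDist x E ^ (γ - 1) *
        (edist x z ^ (1 - (Module.finrank ℝ V : ℝ)) + Metric.infEDist x E ^ (-t) *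
          Metric.infEDist z E ^ (t + 1 - (Module.finrank ℝ V : ℝ))) ∂μ ≤
        C * Metric.infEDist z E ^ γ := by
  set n : ℝ := (Module.finrank ℝ V : ℝ) with hn
  set ω := μ (Metric.ball (0 : V) 1) with hωdef
  have hω : ω ≠ ∞ := measure_ball_lt_top.ne
  obtain ⟨C₁, hC₁⟩ := exists_setLIntegral_rpow_neg_le_le (X := V) (a := n) (b := n - 1)
    (by linarith) (by linarith)
  obtain ⟨C₂, hC₂⟩ := exists_setLIntegral_rpow_neg_ge_le (X := V) (a := n) (b := n - γ)
    (by linarith) (by linarith)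
  obtain ⟨C₃, hC₃⟩ := exists_setLIntegral_rpow_neg_ge_le (X := V) (a := n) (b := 1 + t - γ)
    (by linarith) (by linarith)
  set k₁ : ℝ≥0∞ := 3⁻¹ ^ (γ - 1) with hk₁
  set k₂ : ℝ≥0∞ := 3⁻¹ ^ (γ - 1 - t) with hk₂
  set k₃ : ℝ≥0∞ := 2⁻¹ ^ (γ - 1) with hk₃
  set k₄ : ℝ≥0∞ := 2⁻¹ ^ (γ - 1 - t) with hk₄
  have hkt : ∀ (a : ℝ≥0∞) (c : ℝ), a ≠ 0 → a ≠ ∞ → a ^ c ≠ ∞ := fun a c h0 ht ↦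
    ENNReal.rpow_ne_top_of_ne_zero h0 ht
  set D : ℝ≥0∞ := (k₁ * C₁ + k₂ + (k₃ * C₂ + k₄ * C₃)) * ω with hD
  have hDt : D ≠ ∞ := by
    have h1 := hkt 3⁻¹ (γ - 1) (by simp) (by simp)
    have h2 := hkt 3⁻¹ (γ - 1 - t) (by simp) (by simp)
    have h3 := hkt 2⁻¹ (γ - 1) (by simp) (by simp)
    have h4 := hkt 2⁻¹ (γ - 1 - t) (by simp) (by simp)
    finiteness
  refine ⟨D.toNNReal + 1, fun E hne z ↦ ?_⟩
  rw [ENNReal.coe_add, ENNReal.coe_toNNReal hDt, ENNReal.coe_one]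
  set δ := Metric.infEDist z E with hδ
  have hδt : δ ≠ ∞ := Metric.infEDist_ne_top hne
  by_cases hδ0 : δ = 0
  · rw [hδ0, ENNReal.zero_rpow_of_neg hγ, ENNReal.mul_top (by simp)]
    exact le_top
  have hem : Measurable fun x : V ↦ edist x z := by fun_prop
  have hfm : Measurable fun x : V ↦ Metric.infEDist x E := Metric.continuous_infEDist.measurable
  have hlow : ∀ x, edist x z ≤ 2 * Metric.infEDist x E →
      3⁻¹ * δ ≤ Metric.infEDist x E ∧ 2⁻¹ * edist x z ≤ Metric.infEDist x E := by
    intro x hx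
    refine ⟨?_, ?_⟩
    · rw [ENNReal.inv_mul_le_iff (by simp) (by simp)]
      calc δ ≤ Metric.infEDist x E + edist z x := Metric.infEDist_le_infEDist_add_edist
        _ ≤ Metric.infEDist x E + 2 * Metric.infEDist x E := by
            rw [edist_comm]; gcongr
        _ = 3 * Metric.infEDist x E := by ring
    · rwa [ENNReal.inv_mul_le_iff (by simp) (by simp)]
  have hcomb : ∀ (x : V) (a : ℝ≥0∞), a ≠ 0 → a ≤ Metric.infEDist x E →
      Metric.infEDist x E ^ (γ - 1) * (edist x z ^ (1 - n) + Metric.infEDist x E ^ (-t) *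
        δ ^ (t + 1 - n)) ≤ a ^ (γ - 1) * edist x z ^ (1 - n) +
          a ^ (γ - 1 - t) * δ ^ (t + 1 - n) := by
    intro x a ha0 ha
    have hat : a ≠ ∞ := ne_top_of_le_ne_top (Metric.infEDist_ne_top hne) ha
    have h1 := ENNReal.rpow_le_rpow_of_nonpos (show γ - 1 ≤ 0 by linarith) ha
    have h2 := ENNReal.rpow_le_rpow_of_nonpos (show -t ≤ 0 by linarith) ha
    rw [mul_add, ← mul_assoc, sub_eq_add_neg (γ - 1) t, ENNReal.rpow_add _ _ ha0 hat]
    gcongr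
  set S := {x | edist x z ≤ 2 * Metric.infEDist x E} with hS
  have hSm : MeasurableSet S := measurableSet_le hem (by fun_prop)
  have hbm : MeasurableSet {x : V | edist x z ≤ δ} := measurableSet_le hem measurable_const
  have hbm' : MeasurableSet {x : V | δ ≤ edist x z} := measurableSet_le measurable_const hem
  set f : V → ℝ≥0∞ := fun x ↦ Metric.infEDist x E ^ (γ - 1) *
    (edist x z ^ (1 - n) + Metric.infEDist x E ^ (-t) * δ ^ (t + 1 - n)) with hf
  have hcov : S ⊆ ({x | edist x z ≤ δ} ∩ S) ∪ ({x | δ ≤ edist x z} ∩ S) := fun x hx ↦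
    (le_total (edist x z) δ).imp (fun h ↦ ⟨h, hx⟩) fun h ↦ ⟨h, hx⟩
  have hvol : ∀ r : ℝ≥0∞, r ≠ ∞ → μ {x | edist x z ≤ r} ≤ ω * r ^ n := fun r hr ↦
    (addHaar_edist_le μ z hr).le
  have hin : ∫⁻ x in {x | edist x z ≤ δ} ∩ S, f x ∂μ ≤ (k₁ * C₁ + k₂) * ω * δ ^ γ := by
    have h1 := hC₁ μ (fun x ↦ edist x z) ω δ hem hω hδ0 hδt
      (fun r _ hr ↦ hvol r (ne_top_of_le_ne_top hδt hr))
    calc ∫⁻ x in {x | edist x z ≤ δ} ∩ S, f x ∂μ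
        ≤ ∫⁻ x in {x | edist x z ≤ δ} ∩ S, ((3⁻¹ * δ) ^ (γ - 1) * edist x z ^ (1 - n) +
            (3⁻¹ * δ) ^ (γ - 1 - t) * δ ^ (t + 1 - n)) ∂μ :=
          setLIntegral_mono' (hbm.inter hSm) fun x hx ↦
            hcomb x _ (mul_ne_zero (by simp) hδ0) (hlow x hx.2).1
      _ ≤ ∫⁻ x in {x | edist x z ≤ δ}, ((3⁻¹ * δ) ^ (γ - 1) * edist x z ^ (1 - n) +
            (3⁻¹ * δ) ^ (γ - 1 - t) * δ ^ (t + 1 - n)) ∂μ :=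
          lintegral_mono_set Set.inter_subset_left
      _ = (3⁻¹ * δ) ^ (γ - 1) * ∫⁻ x in {x | edist x z ≤ δ}, edist x z ^ (-(n - 1)) ∂μ +
            (3⁻¹ * δ) ^ (γ - 1 - t) * δ ^ (t + 1 - n) * μ {x | edist x z ≤ δ} := by
          rw [lintegral_add_right _ measurable_const, setLIntegral_const,
            lintegral_const_mul _ (by fun_prop), neg_sub]
      _ ≤ (3⁻¹ * δ) ^ (γ - 1) * (C₁ * ω * δ ^ (n - (n - 1))) +
            (3⁻¹ * δ) ^ (γ - 1 - t) * δ ^ (t + 1 - n) * (ω * δ ^ n) := by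
          gcongr
          exact hvol δ hδt
      _ = k₁ * C₁ * ω * (δ ^ (γ - 1) * δ ^ (n - (n - 1))) +
            k₂ * ω * (δ ^ (γ - 1 - t) * δ ^ (t + 1 - n) * δ ^ n) := by
          rw [ENNReal.mul_rpow_of_ne_zero (by simp) hδ0, ENNReal.mul_rpow_of_ne_zero (by simp) hδ0]
          ring
      _ = _ := by
          rw [← ENNReal.rpow_add _ _ hδ0 hδt, ← ENNReal.rpow_add _ _ hδ0 hδt,
            ← ENNReal.rpow_add _ _ hδ0 hδt]
          ring_nf
  have hout : ∫⁻ x in {x | δ ≤ edist x z} ∩ S, f x ∂μ ≤ (k₃ * C₂ + k₄ * C₃) * ω * δ ^ γ := by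
    have h2 := hC₂ μ (fun x ↦ edist x z) ω δ hem hδ0 hδt (fun r _ hr ↦ hvol r hr)
    have h3 := hC₃ μ (fun x ↦ edist x z) ω δ hem hδ0 hδt (fun r _ hr ↦ hvol r hr)
    calc ∫⁻ x in {x | δ ≤ edist x z} ∩ S, f x ∂μ
        ≤ ∫⁻ x in {x | δ ≤ edist x z} ∩ S, (k₃ * edist x z ^ (-(n - γ)) +
            k₄ * δ ^ (t + 1 - n) * edist x z ^ (-(1 + t - γ))) ∂μ := by
          refine setLIntegral_mono' (hbm'.inter hSm) fun x hx ↦ ?_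
          have he0 : edist x z ≠ 0 := fun h0 ↦ hδ0 (le_antisymm (h0 ▸ hx.1) zero_le)
          have het : edist x z ≠ ∞ := edist_ne_top _ _
          refine (hcomb x _ (mul_ne_zero (by simp) he0) (hlow x hx.2).2).trans_eq ?_
          rw [ENNReal.mul_rpow_of_ne_zero (by simp) he0, ENNReal.mul_rpow_of_ne_zero (by simp) he0,
            ← hk₃, ← hk₄, mul_assoc, ← ENNReal.rpow_add _ _ he0 het,
            show γ - 1 + (1 - n) = -(n - γ) by ring, show γ - 1 - t = -(1 + t - γ) by ring]
          ring
      _ ≤ ∫⁻ x in {x | δ ≤ edist x z}, (k₃ * edist x z ^ (-(n - γ)) +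
            k₄ * δ ^ (t + 1 - n) * edist x z ^ (-(1 + t - γ))) ∂μ :=
          lintegral_mono_set Set.inter_subset_left
      _ = k₃ * ∫⁻ x in {x | δ ≤ edist x z}, edist x z ^ (-(n - γ)) ∂μ +
            k₄ * δ ^ (t + 1 - n) * ∫⁻ x in {x | δ ≤ edist x z}, edist x z ^ (-(1 + t - γ)) ∂μ := by
          rw [lintegral_add_left (by fun_prop), lintegral_const_mul _ (by fun_prop),
            lintegral_const_mul _ (by fun_prop)]
      _ ≤ k₃ * (C₂ * ω * δ ^ (n - (n - γ))) +
            k₄ * δ ^ (t + 1 - n) * (C₃ * ω * δ ^ (n - (1 + t - γ))) := by gcongr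
      _ = k₃ * C₂ * ω * δ ^ (n - (n - γ)) +
            k₄ * C₃ * ω * (δ ^ (t + 1 - n) * δ ^ (n - (1 + t - γ))) := by ring
      _ = _ := by
          rw [← ENNReal.rpow_add _ _ hδ0 hδt]
          ring_nf
  calc ∫⁻ x in S, f x ∂μ
      ≤ ∫⁻ x in ({x | edist x z ≤ δ} ∩ S) ∪ ({x | δ ≤ edist x z} ∩ S), f x ∂μ :=
        lintegral_mono_set hcov
    _ ≤ _ := lintegral_union_le _ _ _
    _ ≤ (k₁ * C₁ + k₂) * ω * δ ^ γ + (k₃ * C₂ + k₄ * C₃) * ω * δ ^ γ := add_le_add hin hout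
    _ = D * δ ^ γ := by rw [hD]; ring
    _ ≤ (D + 1) * δ ^ γ := by gcongr; exact le_self_add

end Thick

/-! ### `L¹` Hardy inequality for thick sets -/

section ThickHardy

variable {V : Type*} [NormedAddCommGroup V] [NormedSpace ℝ V] [FiniteDimensional ℝ V]
  [MeasurableSpace V] [BorelSpace V] (μ : Measure V) [μ.IsAddHaarMeasure]

/-- The `L¹` Hardy inequality for sets of large lower Assouad dimension. -/
theorem LowerAssouadExponent.exists_hardy [Nontrivial V] {E : Set V} {t₀ γ : ℝ}
    (hE : IsClosed E) (hγ : γ < 0) (hn : 0 < (Module.finrank ℝ V : ℝ) - 1 + γ)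
    (ht₀ : (Module.finrank ℝ V : ℝ) - 1 + γ < t₀) (h : LowerAssouadExponent E t₀) :
    ∃ C : ℝ≥0, ∀ (v : V → ℝ) (K : ℝ≥0), LipschitzWith K v → HasCompactSupport v →
      Disjoint (tsupport v) E →
      ∫⁻ x, ‖v x‖ₑ * Metric.infEDist x E ^ (γ - 1) ∂μ ≤
        C * ∫⁻ x, ‖fderiv ℝ v x‖ₑ * Metric.infEDist x E ^ γ ∂μ := by
  rcases E.eq_empty_or_nonempty with rfl | hne
  · exact ⟨1, fun v K _ _ _ ↦ by simp [ENNReal.top_rpow_of_neg (show γ - 1 < 0 by linarith)]⟩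
  set n : ℝ := (Module.finrank ℝ V : ℝ) with hndef
  -- The growth exponent must be below `t₀` for the measures to exist, below `n - 1` for the kernel
  -- integral against them, and above `n - 1 + γ` for the adjoint estimate.
  obtain ⟨t, ht1, ht2⟩ := exists_between (lt_min ht₀ (by linarith : n - 1 + γ < n - 1))
  rw [lt_min_iff] at ht2
  obtain ⟨C₁, hC₁⟩ := h.exists_enorm_le μ hE (hn.le.trans ht1.le) ht2.1 ht2.2
  obtain ⟨C₂, hC₂⟩ := exists_setLIntegral_potential_le μ (γ := γ) (t := t) (by linarith) hγ
    (hn.le.trans ht1.le) ht1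
  obtain ⟨y, hy⟩ := hne
  -- The condition is vacuous: a point has diameter `0`.
  have hsing : UpperAssouadExponent ({y} : Set V) 0 :=
    ⟨1, le_rfl, fun x _ r R _ _ hR ↦ by simp at hR⟩
  obtain ⟨C₃, hC₃⟩ := hsing.exists_hardy μ le_rfl hγ hn
  have hkt : (2⁻¹ : ℝ≥0∞) ^ (γ - 1) ≠ ∞ :=
    ENNReal.rpow_ne_top_of_ne_zero (by simp) (by simp)
  refine ⟨C₁ * C₂ + ((2⁻¹ : ℝ≥0∞) ^ (γ - 1)).toNNReal * C₃, fun v K hv hvc hvE ↦ ?_⟩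
  have hfm : Measurable fun x : V ↦ Metric.infEDist x E := Metric.continuous_infEDist.measurable
  set g : V → ℝ≥0∞ := fun z ↦ ‖fderiv ℝ v z‖ₑ
  have hg : Measurable g := (measurable_fderiv ℝ v).enorm
  set S := {x | Metric.infEDist x E < Metric.ediam E} with hS
  have hSm : MeasurableSet S := measurableSet_lt hfm measurable_const
  rw [← lintegral_add_compl _ hSm, ENNReal.coe_add, add_mul]
  refine add_le_add ?_ ?_
  · have hsm : MeasurableSet {q : V × V | edist q.1 q.2 ≤ 2 * Metric.infEDist q.1 E} :=
      measurableSet_le (by fun_prop) (by fun_prop)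
    obtain ⟨k, hkm, hk⟩ : ∃ k : V → V → ℝ≥0∞, Measurable (Function.uncurry k) ∧ ∀ x z, k x z =
        {q : V × V | edist q.1 q.2 ≤ 2 * Metric.infEDist q.1 E}.indicator
          (fun q ↦ Metric.infEDist q.1 E ^ (γ - 1) * (edist q.1 q.2 ^ (1 - n) +
          Metric.infEDist q.1 E ^ (-t) * Metric.infEDist q.2 E ^ (t + 1 - n))) (x, z) := by
      have hfun : Measurable fun q : V × V ↦ Metric.infEDist q.1 E ^ (γ - 1) *
          (edist q.1 q.2 ^ (1 - n) + Metric.infEDist q.1 E ^ (-t) *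
            Metric.infEDist q.2 E ^ (t + 1 - n)) := by fun_prop
      have hind := hfun.indicator hsm
      rw [← Function.uncurry_curry (Set.indicator _ _)] at hind
      exact ⟨_, hind, fun _ _ ↦ rfl⟩
    have hpt : ∀ x ∈ S, ‖v x‖ₑ * Metric.infEDist x E ^ (γ - 1) ≤ C₁ * ∫⁻ z, g z * k x z ∂μ := by
      intro x hx
      calc ‖v x‖ₑ * Metric.infEDist x E ^ (γ - 1)
          ≤ C₁ * (∫⁻ z in {z | edist x z ≤ 2 * Metric.infEDist x E}, g z *
            (edist x z ^ (1 - n) + Metric.infEDist x E ^ (-t) *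
              Metric.infEDist z E ^ (t + 1 - n)) ∂μ) * Metric.infEDist x E ^ (γ - 1) := by
            gcongr
            exact hC₁ v K hv hvc hvE x hx
        _ = C₁ * ∫⁻ z in {z | edist x z ≤ 2 * Metric.infEDist x E}, g z *
            (edist x z ^ (1 - n) + Metric.infEDist x E ^ (-t) *
              Metric.infEDist z E ^ (t + 1 - n)) * Metric.infEDist x E ^ (γ - 1) ∂μ := by
            rw [lintegral_mul_const _ (by fun_prop), mul_assoc]
        _ = _ := by
            rw [← lintegral_indicator (measurableSet_le (by fun_prop) (by fun_prop))]
            congr 1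
            refine lintegral_congr fun z ↦ ?_
            simp only [hk, Set.indicator_apply, Set.mem_ofPred_eq]
            split_ifs
            · ring
            · simp
    calc ∫⁻ x in S, ‖v x‖ₑ * Metric.infEDist x E ^ (γ - 1) ∂μ
        ≤ ∫⁻ x in S, C₁ * ∫⁻ z, g z * k x z ∂μ ∂μ := setLIntegral_mono' hSm hpt
      _ ≤ ∫⁻ x, C₁ * ∫⁻ z, g z * k x z ∂μ ∂μ := setLIntegral_le_lintegral _ _
      _ = C₁ * ∫⁻ z, ∫⁻ x, g z * k x z ∂μ ∂μ := by
          have hm : Measurable (Function.uncurry fun x z : V ↦ g z * k x z) :=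
            (hg.comp measurable_snd).mul hkm
          rw [← lintegral_lintegral_swap hm.aemeasurable]
          exact lintegral_const_mul _ hm.lintegral_prod_right'
      _ ≤ C₁ * ∫⁻ z, C₂ * (g z * Metric.infEDist z E ^ γ) ∂μ := by
          refine mul_le_mul_right (lintegral_mono fun z ↦ ?_) _
          have hkz : Measurable fun x ↦ k x z := hkm.comp measurable_prodMk_right
          simp only
          rw [lintegral_const_mul _ hkz, mul_left_comm]
          refine mul_le_mul_right (le_trans (le_of_eq ?_) (hC₂ E ⟨y, hy⟩ z)) _
          rw [← lintegral_indicator (measurableSet_le (by fun_prop) (by fun_prop))]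
          refine lintegral_congr fun x ↦ ?_
          simp only [hk, Set.indicator_apply, Set.mem_ofPred_eq, hndef]
      _ = _ := by
          rw [lintegral_const_mul _ (by fun_prop), ENNReal.coe_mul, mul_assoc]
  -- Here `diam E ≤ d_E(x)`, so `|x - y| ≤ 2 d_E(x)` and the weight passes to the single point `y`.
  -- On the gradient side `d_E(x) ≤ |x - y|` passes it back.
  · have hpt : ∀ x ∈ Sᶜ, ‖v x‖ₑ * Metric.infEDist x E ^ (γ - 1) ≤
        (2⁻¹ : ℝ≥0∞) ^ (γ - 1) * (‖v x‖ₑ * Metric.infEDist x {y} ^ (γ - 1)) := by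
      intro x hx
      have hx' : Metric.ediam E ≤ Metric.infEDist x E := le_of_not_gt hx
      have h1 : edist x y ≤ 2 * Metric.infEDist x E := by
        calc edist x y ≤ Metric.infEDist x E + Metric.ediam E :=
              Metric.edist_le_infEDist_add_ediam hy
          _ ≤ Metric.infEDist x E + Metric.infEDist x E := by gcongr
          _ = _ := (two_mul _).symm
      by_cases hxy : edist x y = 0
      · have : v x = 0 := by
          rw [edist_eq_zero.1 hxy]
          exact image_eq_zero_of_notMem_tsupport fun hy' ↦ Set.disjoint_left.1 hvE hy' hy
        simp [this]
      have h2 : 2⁻¹ * edist x y ≤ Metric.infEDist x E := by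
        rwa [ENNReal.inv_mul_le_iff (by simp) (by simp)]
      rw [mul_left_comm, Metric.infEDist_singleton,
        ← ENNReal.mul_rpow_of_ne_zero (by simp) hxy]
      exact mul_le_mul_right (ENNReal.rpow_le_rpow_of_nonpos (by linarith) h2) _
    calc ∫⁻ x in Sᶜ, ‖v x‖ₑ * Metric.infEDist x E ^ (γ - 1) ∂μ
        ≤ ∫⁻ x in Sᶜ, (2⁻¹ : ℝ≥0∞) ^ (γ - 1) *
            (‖v x‖ₑ * Metric.infEDist x {y} ^ (γ - 1)) ∂μ := setLIntegral_mono' hSm.compl hpt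
      _ ≤ ∫⁻ x, (2⁻¹ : ℝ≥0∞) ^ (γ - 1) * (‖v x‖ₑ * Metric.infEDist x {y} ^ (γ - 1)) ∂μ :=
          setLIntegral_le_lintegral _ _
      _ = (2⁻¹ : ℝ≥0∞) ^ (γ - 1) * ∫⁻ x, ‖v x‖ₑ * Metric.infEDist x {y} ^ (γ - 1) ∂μ :=
          lintegral_const_mul' _ _ hkt
      _ ≤ (2⁻¹ : ℝ≥0∞) ^ (γ - 1) * (C₃ * ∫⁻ x, g x * Metric.infEDist x {y} ^ γ ∂μ) := by
          gcongr
          exact hC₃ v K hv hvc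
      _ ≤ (2⁻¹ : ℝ≥0∞) ^ (γ - 1) * (C₃ * ∫⁻ x, g x * Metric.infEDist x E ^ γ ∂μ) := by
          refine mul_le_mul_right (mul_le_mul_right (lintegral_mono fun x ↦ ?_) _) _
          refine mul_le_mul_right ?_ _
          exact ENNReal.rpow_le_rpow_of_nonpos hγ.le
            (Metric.infEDist_anti (Set.singleton_subset_iff.2 hy))
      _ = _ := by rw [ENNReal.coe_mul, ENNReal.coe_toNNReal hkt, mul_assoc]

end ThickHardy

/-! ### Extension by zero and powers of Lipschitz functions -/

/-- A Lipschitz function with compact support in `Ω` extends by zero to a Lipschitz function. -/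
theorem LipschitzOnWith.indicator_of_closure_subset {V : Type*} [NormedAddCommGroup V]
    [NormedSpace ℝ V] {Ω : Set V} {u : V → ℝ} {K : ℝ≥0} (hΩ : IsOpen Ω)
    (hu : LipschitzOnWith K u Ω) (hsub : closure {x | x ∈ Ω ∧ u x ≠ 0} ⊆ Ω) :
    LipschitzWith K (Ω.indicator u) := by
  set S := closure {x | x ∈ Ω ∧ u x ≠ 0} with hS
  have key : ∀ x ∈ Ω, ∀ y ∉ Ω, ‖u x‖ ≤ K * dist x y := by
    intro x hx y hy
    -- The segment is connected and covered by the open sets `Ω` and `Sᶜ`, so it contains a point of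
    -- both, where `u` vanishes.
    obtain ⟨z, hz, hzΩ, hzS⟩ := (convex_segment (𝕜 := ℝ) x y).isPreconnected Ω Sᶜ hΩ
      isClosed_closure.isOpen_compl
      (fun z _ ↦ (em (z ∈ S)).imp (fun h ↦ hsub h) id)
      ⟨x, left_mem_segment ℝ x y, hx⟩ ⟨y, right_mem_segment ℝ x y, fun h ↦ hy (hsub h)⟩
    have huz : u z = 0 := by
      by_contra h
      exact hzS (subset_closure ⟨hzΩ, h⟩)
    have h1 := hu.dist_le_mul x hx z hzΩ
    rw [huz, dist_zero_right] at h1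
    have h2 := dist_add_dist_of_mem_segment hz
    refine h1.trans (mul_le_mul_of_nonneg_left ?_ K.coe_nonneg)
    linarith [dist_nonneg (x := z) (y := y)]
  refine LipschitzWith.of_dist_le_mul fun x y ↦ ?_
  by_cases hx : x ∈ Ω <;> by_cases hy : y ∈ Ω
  · rw [Set.indicator_of_mem hx, Set.indicator_of_mem hy]
    exact hu.dist_le_mul x hx y hy
  · rw [Set.indicator_of_mem hx, Set.indicator_of_notMem hy, dist_zero_right]
    exact key x hx y hy
  · rw [Set.indicator_of_notMem hx, Set.indicator_of_mem hy, dist_zero_left, dist_comm]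
    exact key y hy x hx
  · rw [Set.indicator_of_notMem hx, Set.indicator_of_notMem hy, dist_self]
    positivity

/-- The values of `U` are bounded, and `|t|^p` is `C¹` for `p > 1`, hence Lipschitz on bounded
intervals. -/
theorem LipschitzWith.exists_norm_rpow {V : Type*} [NormedAddCommGroup V] {U : V → ℝ} {K : ℝ≥0}
    (hU : LipschitzWith K U) (hUc : HasCompactSupport U) {p : ℝ} (hp : 1 < p) :
    ∃ K' : ℝ≥0, LipschitzWith K' fun x ↦ ‖U x‖ ^ p := by
  obtain ⟨M, hM⟩ := hUc.exists_bound_of_continuous hU.continuous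
  obtain ⟨L, hL⟩ := (contDiff_norm_rpow (E := ℝ) hp).contDiffOn.exists_lipschitzOnWith one_ne_zero
    (convex_closedBall (0 : ℝ) M) (isCompact_closedBall 0 M)
  refine ⟨L * K, fun x y ↦ ?_⟩
  refine (hL (by simpa using hM x) (by simpa using hM y)).trans ?_
  rw [ENNReal.coe_mul, mul_assoc]
  gcongr
  exact hU x y

/-! ### Combining the two sets and passing from `L¹` to `L^p` -/

section Final

variable {V : Type*} [NormedAddCommGroup V] [NormedSpace ℝ V]

theorem enorm_fderiv_norm_comp_rpow_le {U : V → ℝ} {x : V} (hx : DifferentiableAt ℝ U x) {p : ℝ}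
    (hp : 1 < p) :
    ‖fderiv ℝ (fun x ↦ ‖U x‖ ^ p) x‖ₑ ≤
      ENNReal.ofReal p * (‖U x‖ₑ ^ (p - 1) * ‖fderiv ℝ U x‖ₑ) := by
  have h1 : fderiv ℝ (fun x ↦ ‖U x‖ ^ p) x =
      (fderiv ℝ (fun t : ℝ ↦ ‖t‖ ^ p) (U x)).comp (fderiv ℝ U x) :=
    fderiv_comp x (g := fun t : ℝ ↦ ‖t‖ ^ p) (differentiable_norm_rpow hp _) hx
  have h2 : ‖fderiv ℝ (fun x ↦ ‖U x‖ ^ p) x‖ ≤ p * ‖U x‖ ^ (p - 1) * ‖fderiv ℝ U x‖ := by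
    rw [h1]
    refine (ContinuousLinearMap.opNorm_comp_le _ _).trans_eq ?_
    rw [norm_fderiv_norm_id_rpow _ hp]
  rw [← ofReal_norm, ← ofReal_norm, ← ofReal_norm,
    ENNReal.ofReal_rpow_of_nonneg (norm_nonneg _) (by linarith), ← ENNReal.ofReal_mul (by positivity),
    ← ENNReal.ofReal_mul (by linarith), ← mul_assoc]
  exact ENNReal.ofReal_le_ofReal h2

variable [FiniteDimensional ℝ V] [MeasurableSpace V] [BorelSpace V]
  (μ : Measure V) [μ.IsAddHaarMeasure]

theorem ENNReal.min_rpow_le_add (a b : ℝ≥0∞) (c : ℝ) : (min a b) ^ c ≤ a ^ c + b ^ c := by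
  rcases min_choice a b with h | h <;> rw [h]
  exacts [le_self_add, le_add_self]

/-- The `L¹` Hardy inequality for the union of a set of large lower Assouad dimension and a set of
small Assouad dimension. -/
theorem exists_hardy_union [Nontrivial V] {E F : Set V} {t s γ : ℝ} (hE : IsClosed E)
    (hγ : γ < 0) (hs : 0 ≤ s) (hsγ : s < (Module.finrank ℝ V : ℝ) - 1 + γ)
    (htγ : (Module.finrank ℝ V : ℝ) - 1 + γ < t) (hEt : LowerAssouadExponent E t)
    (hFs : UpperAssouadExponent F s) :
    ∃ C : ℝ≥0, ∀ (v : V → ℝ) (K : ℝ≥0), LipschitzWith K v → HasCompactSupport v →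
      Disjoint (tsupport v) E →
      ∫⁻ x, ‖v x‖ₑ * Metric.infEDist x (E ∪ F) ^ (γ - 1) ∂μ ≤
        C * ∫⁻ x, ‖fderiv ℝ v x‖ₑ * Metric.infEDist x (E ∪ F) ^ γ ∂μ := by
  obtain ⟨C₁, hC₁⟩ := hEt.exists_hardy μ hE hγ (by linarith) htγ
  obtain ⟨C₂, hC₂⟩ := hFs.exists_hardy μ hs hγ hsγ
  refine ⟨C₁ + C₂, fun v K hv hvc hvE ↦ ?_⟩
  have hvm : Measurable fun x ↦ ‖v x‖ₑ := hv.continuous.measurable.enorm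
  calc ∫⁻ x, ‖v x‖ₑ * Metric.infEDist x (E ∪ F) ^ (γ - 1) ∂μ
      ≤ ∫⁻ x, (‖v x‖ₑ * Metric.infEDist x E ^ (γ - 1) +
          ‖v x‖ₑ * Metric.infEDist x F ^ (γ - 1)) ∂μ := by
        refine lintegral_mono fun x ↦ ?_
        simp only
        rw [← mul_add, Metric.infEDist_union]
        exact mul_le_mul_right (ENNReal.min_rpow_le_add _ _ _) _
    _ = ∫⁻ x, ‖v x‖ₑ * Metric.infEDist x E ^ (γ - 1) ∂μ +
          ∫⁻ x, ‖v x‖ₑ * Metric.infEDist x F ^ (γ - 1) ∂μ :=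
        lintegral_add_left (by fun_prop) _
    _ ≤ C₁ * ∫⁻ x, ‖fderiv ℝ v x‖ₑ * Metric.infEDist x E ^ γ ∂μ +
          C₂ * ∫⁻ x, ‖fderiv ℝ v x‖ₑ * Metric.infEDist x F ^ γ ∂μ :=
        add_le_add (hC₁ v K hv hvc hvE) (hC₂ v K hv hvc)
    _ ≤ C₁ * ∫⁻ x, ‖fderiv ℝ v x‖ₑ * Metric.infEDist x (E ∪ F) ^ γ ∂μ +
          C₂ * ∫⁻ x, ‖fderiv ℝ v x‖ₑ * Metric.infEDist x (E ∪ F) ^ γ ∂μ := by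
        refine add_le_add ?_ ?_ <;> refine mul_le_mul_right (lintegral_mono fun x ↦ ?_) _ <;>
          refine mul_le_mul_right (ENNReal.rpow_le_rpow_of_nonpos hγ.le (Metric.infEDist_anti ?_)) _
        exacts [Set.subset_union_left, Set.subset_union_right]
    _ = _ := by rw [ENNReal.coe_add, add_mul]

/-- This finiteness licenses the division after Hölder. On the support the distance to `E` is
bounded below, and the power of `d_F` is locally integrable. -/
theorem lintegral_enorm_mul_infEDist_union_rpow_lt_top {E F : Set V} {s b : ℝ} (hE : IsClosed E)
    (hs : 0 ≤ s) (hFs : UpperAssouadExponent F s) (hb : 0 < b)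
    (hbs : b < (Module.finrank ℝ V : ℝ) - s) {v : V → ℝ} (hv : Continuous v)
    (hvc : HasCompactSupport v) (hvE : Disjoint (tsupport v) E) :
    ∫⁻ x, ‖v x‖ₑ * Metric.infEDist x (E ∪ F) ^ (-b) ∂μ < ∞ := by
  obtain ⟨C, hC⟩ := hFs.exists_setLIntegral_infEDist_rpow_le μ hs hb hbs
  obtain ⟨M, hM⟩ := hvc.exists_bound_of_continuous hv
  obtain ⟨η, hη0, hη⟩ := Metric.exists_pos_forall_lt_edist hvc.isCompact hE hvE
  obtain ⟨R, hR0, hR⟩ : ∃ R : ℝ, 0 < R ∧ tsupport v ⊆ Metric.closedBall 0 R := by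
    obtain ⟨ρ, hρ⟩ := (HasCompactSupport.isCompact hvc).isBounded.subset_closedBall 0
    exact ⟨max ρ 1, by positivity, hρ.trans (Metric.closedBall_subset_closedBall (le_max_left _ _))⟩
  set B := {x : V | edist x 0 ≤ ENNReal.ofReal R} with hB
  have hBm : MeasurableSet B := measurableSet_le (by fun_prop) measurable_const
  have hfm : Measurable fun x : V ↦ Metric.infEDist x F := Metric.continuous_infEDist.measurable
  calc ∫⁻ x, ‖v x‖ₑ * Metric.infEDist x (E ∪ F) ^ (-b) ∂μ
      ≤ ∫⁻ x in B, ENNReal.ofReal M * ((η : ℝ≥0∞) ^ (-b) + Metric.infEDist x F ^ (-b)) ∂μ := by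
        rw [← lintegral_indicator hBm]
        refine lintegral_mono fun x ↦ ?_
        by_cases hx : x ∈ tsupport v
        · have hxB : x ∈ B := by
            have h1 := Metric.mem_closedBall.1 (hR hx)
            change edist x 0 ≤ _
            rw [edist_dist]
            exact ENNReal.ofReal_le_ofReal h1
          rw [Set.indicator_of_mem hxB, Metric.infEDist_union]
          refine mul_le_mul' ?_ ((ENNReal.min_rpow_le_add _ _ _).trans ?_)
          · rw [← ofReal_norm]
            exact ENNReal.ofReal_le_ofReal (hM x)
          · refine add_le_add_left (ENNReal.rpow_le_rpow_of_nonpos (by linarith) ?_) _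
            exact Metric.le_infEDist.2 fun w hw ↦ (hη x hx w hw).le
        · simp [image_eq_zero_of_notMem_tsupport hx]
    _ = ENNReal.ofReal M * ((η : ℝ≥0∞) ^ (-b) * μ B +
          ∫⁻ x in B, Metric.infEDist x F ^ (-b) ∂μ) := by
        rw [lintegral_const_mul _ (by fun_prop), lintegral_add_left measurable_const,
          setLIntegral_const]
    _ < ∞ := by
        have h1 : (η : ℝ≥0∞) ^ (-b) ≠ ∞ :=
          ENNReal.rpow_ne_top_of_ne_zero (by simpa using hη0.ne') ENNReal.coe_ne_top
        have h2 : ENNReal.ofReal R ^ ((Module.finrank ℝ V : ℝ) - b) ≠ ∞ :=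
          ENNReal.rpow_ne_top_of_ne_zero (by simpa using hR0) ENNReal.ofReal_ne_top
        have h3 := hC 0 (ENNReal.ofReal R) (by simpa using hR0) ENNReal.ofReal_ne_top
        have h4 : ∫⁻ x in B, Metric.infEDist x F ^ (-b) ∂μ ≠ ∞ :=
          ne_top_of_le_ne_top (ENNReal.mul_ne_top ENNReal.coe_ne_top h2) h3
        have h5 : μ B ≠ ∞ := by
          rw [hB, addHaar_edist_le μ 0 ENNReal.ofReal_ne_top]
          exact ENNReal.mul_ne_top measure_ball_lt_top.ne
            (ENNReal.rpow_ne_top_of_nonneg (by positivity) ENNReal.ofReal_ne_top)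
        finiteness

/-- The `L^p` Hardy inequality for Lipschitz functions on the whole space that vanish near the
thick part of the complement. -/
theorem exists_hardy_rpow_union [Nontrivial V] {E F : Set V} {t s p β : ℝ} (hp : 1 < p)
    (hβ : β < p - 1) (hE : IsClosed E) (hF : IsClosed F) (hs : 0 ≤ s)
    (hsβ : s < (Module.finrank ℝ V : ℝ) - p + β) (htβ : (Module.finrank ℝ V : ℝ) - p + β < t)
    (hEt : LowerAssouadExponent E t) (hFs : UpperAssouadExponent F s) :
    ∃ C : ℝ≥0, 0 < C ∧ ∀ (U : V → ℝ) (K : ℝ≥0), LipschitzWith K U → HasCompactSupport U →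
      Disjoint (tsupport U) E →
      ∫⁻ x in (E ∪ F)ᶜ, ‖U x‖ₑ ^ p * Metric.infEDist x (E ∪ F) ^ (β - p) ∂μ ≤
        C * ∫⁻ x in (E ∪ F)ᶜ, ‖fderiv ℝ U x‖ₑ ^ p * Metric.infEDist x (E ∪ F) ^ β ∂μ := by
  have hp0 : 0 < p := by linarith
  obtain ⟨C, hC⟩ := exists_hardy_union μ (γ := β - p + 1) hE (by linarith) hs (by linarith)
    (by linarith) hEt hFs
  set D : ℝ≥0∞ := C * ENNReal.ofReal p with hD
  have hDt : D ≠ ∞ := ENNReal.mul_ne_top ENNReal.coe_ne_top ENNReal.ofReal_ne_top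
  have hDpt : D ^ p ≠ ∞ := ENNReal.rpow_ne_top_of_nonneg hp0.le hDt
  refine ⟨(D ^ p).toNNReal + 1, by positivity, fun U K hU hUc hUE ↦ ?_⟩
  rw [ENNReal.coe_add, ENNReal.coe_toNNReal hDpt, ENNReal.coe_one]
  set d : V → ℝ≥0∞ := fun x ↦ Metric.infEDist x (E ∪ F) with hd
  have hdm : Measurable d := Metric.continuous_infEDist.measurable
  set Ω := (E ∪ F)ᶜ with hΩ
  have hΩo : IsOpen Ω := (hE.union hF).isOpen_compl
  rcases (E ∪ F).eq_empty_or_nonempty with hemp | hne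
  · simp [hemp, ENNReal.top_rpow_of_neg (show β - p < 0 by linarith)]
  have hdt : ∀ x, d x ≠ ∞ := fun x ↦ Metric.infEDist_ne_top hne
  have hd0 : ∀ x ∈ Ω, d x ≠ 0 := fun x hx h0 ↦
    hx ((Metric.mem_iff_infEDist_zero_of_closed (hE.union hF)).2 h0)
  set v : V → ℝ := fun x ↦ ‖U x‖ ^ p with hv
  have hve : ∀ x, ‖v x‖ₑ = ‖U x‖ₑ ^ p := fun x ↦ by
    rw [← ofReal_norm, ← ofReal_norm,
      ENNReal.ofReal_rpow_of_nonneg (norm_nonneg _) hp0.le,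
      Real.norm_of_nonneg (Real.rpow_nonneg (norm_nonneg _) _)]
  obtain ⟨K', hvL⟩ : ∃ K', LipschitzWith K' v := hU.exists_norm_rpow hUc hp
  have hvs : tsupport v ⊆ tsupport U := closure_mono fun x hx hx0 ↦ hx (by
    simp [hv, hx0, Real.zero_rpow hp0.ne'])
  have hvc : HasCompactSupport v := hUc.of_isClosed_subset isClosed_closure hvs
  have hvE : Disjoint (tsupport v) E := hUE.mono_left hvs
  -- The `L¹` inequality integrates over the whole space, where the weight is `∞` on `F`; nullity of
  -- `F` lets the gradient integral be restricted to `Ω`.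
  have hFnull : μ F = 0 := hFs.measure_eq_zero μ hs (by linarith)
  have hγ : β - p + 1 - 1 = β - p := by ring
  have h1 := hC v K' hvL hvc hvE
  simp only [hve, hγ] at h1
  set A := ∫⁻ x in Ω, ‖U x‖ₑ ^ p * d x ^ (β - p) ∂μ with hA
  set B := ∫⁻ x in Ω, ‖fderiv ℝ U x‖ₑ ^ p * d x ^ β ∂μ with hB
  have hAt : A ≠ ∞ := by
    have h2 := lintegral_enorm_mul_infEDist_union_rpow_lt_top μ (b := p - β) hE hs hFs
      (by linarith) (by linarith) hvL.continuous hvc hvE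
    simp only [hve, neg_sub] at h2
    exact ((setLIntegral_le_lintegral _ _).trans_lt h2).ne
  -- Hölder with weights `1 - 1/p` and `1/p`; the exponents match since `β - p + 1 = (β - p)(1 -
  -- 1/p) + β/p`.
  have hrhs : ∫⁻ x, ‖fderiv ℝ v x‖ₑ * d x ^ (β - p + 1) ∂μ ≤
      ENNReal.ofReal p * (A ^ (1 - 1 / p) * B ^ (1 / p)) := by
    calc ∫⁻ x, ‖fderiv ℝ v x‖ₑ * d x ^ (β - p + 1) ∂μ
        = ∫⁻ x in Ω, ‖fderiv ℝ v x‖ₑ * d x ^ (β - p + 1) ∂μ := by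
          rw [← lintegral_indicator hΩo.measurableSet]
          refine lintegral_congr_ae ?_
          have hFae : ∀ᵐ x ∂μ, x ∉ F := measure_eq_zero_iff_ae_notMem.1 hFnull
          filter_upwards [hFae] with x hxF
          by_cases hx : x ∈ Ω
          · rw [Set.indicator_of_mem hx]
          · have hxE : x ∈ E := by
              by_contra hxE
              exact hx fun h ↦ h.elim hxE hxF
            have h0 : fderiv ℝ v x = 0 := by
              by_contra h0
              exact Set.disjoint_left.1 hvE (support_fderiv_subset ℝ h0) hxE
            rw [Set.indicator_of_notMem hx, h0, enorm_zero (E := V →L[ℝ] ℝ), zero_mul]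
      _ ≤ ∫⁻ x in Ω, ENNReal.ofReal p * ((‖U x‖ₑ ^ p * d x ^ (β - p)) ^ (1 - 1 / p) *
            (‖fderiv ℝ U x‖ₑ ^ p * d x ^ β) ^ (1 / p)) ∂μ := by
          refine lintegral_mono_ae ?_
          filter_upwards [ae_restrict_of_ae hU.ae_differentiableAt,
            ae_restrict_mem hΩo.measurableSet] with x hx hxΩ
          refine (mul_le_mul_left (enorm_fderiv_norm_comp_rpow_le hx hp) _).trans_eq ?_
          have hp1 : 0 ≤ 1 - 1 / p := by
            rw [sub_nonneg, div_le_one hp0]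
            exact hp.le
          rw [ENNReal.mul_rpow_of_nonneg _ _ hp1, ENNReal.mul_rpow_of_nonneg _ _ (by positivity),
            ← ENNReal.rpow_mul, ← ENNReal.rpow_mul, ← ENNReal.rpow_mul, ← ENNReal.rpow_mul,
            show p * (1 - 1 / p) = p - 1 by field_simp, mul_one_div_cancel hp0.ne',
            ENNReal.rpow_one, show β - p + 1 = (β - p) * (1 - 1 / p) + β * (1 / p) by
              field_simp; ring, ENNReal.rpow_add _ _ (hd0 x hxΩ) (hdt x)]
          ring
      _ = ENNReal.ofReal p * ∫⁻ x in Ω, (‖U x‖ₑ ^ p * d x ^ (β - p)) ^ (1 - 1 / p) *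
            (‖fderiv ℝ U x‖ₑ ^ p * d x ^ β) ^ (1 / p) ∂μ :=
          lintegral_const_mul' _ _ ENNReal.ofReal_ne_top
      _ ≤ _ := by
          have hUm : Measurable fun x ↦ ‖U x‖ₑ := hU.continuous.measurable.enorm
          have hgm : Measurable fun x ↦ ‖fderiv ℝ U x‖ₑ := (measurable_fderiv ℝ U).enorm
          refine mul_le_mul_right (ENNReal.lintegral_mul_norm_pow_le ?_ ?_ ?_ ?_ ?_) _
          · exact ((hUm.pow_const _).mul (hdm.pow_const _)).aemeasurable
          · exact ((hgm.pow_const _).mul (hdm.pow_const _)).aemeasurable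
          · rw [sub_nonneg, div_le_one hp0]
            exact hp.le
          · positivity
          · ring
  have h2 : A ≤ D * (A ^ (1 - 1 / p) * B ^ (1 / p)) := by
    calc A ≤ _ := setLIntegral_le_lintegral _ _
      _ ≤ _ := h1
      _ ≤ C * (ENNReal.ofReal p * (A ^ (1 - 1 / p) * B ^ (1 / p))) := mul_le_mul_right hrhs _
      _ = _ := by rw [hD, mul_assoc]
  by_cases hA0 : A = 0
  · rw [hA0]; exact zero_le
  have h3 : A ^ (1 / p) ≤ D * B ^ (1 / p) := by
    have hX0 : A ^ (1 - 1 / p) ≠ 0 := (ENNReal.rpow_pos (pos_iff_ne_zero.2 hA0) hAt).ne'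
    have hXt : A ^ (1 - 1 / p) ≠ ∞ := ENNReal.rpow_ne_top_of_ne_zero hA0 hAt
    rw [← ENNReal.mul_le_mul_iff_right hX0 hXt, ← ENNReal.rpow_add _ _ hA0 hAt, sub_add_cancel,
      ENNReal.rpow_one, mul_left_comm]
    exact h2
  calc A = (A ^ (1 / p)) ^ p := by
        rw [← ENNReal.rpow_mul, one_div_mul_cancel hp0.ne', ENNReal.rpow_one]
    _ ≤ (D * B ^ (1 / p)) ^ p := by gcongr
    _ = D ^ p * B := by
        rw [ENNReal.mul_rpow_of_nonneg _ _ hp0.le, ← ENNReal.rpow_mul, one_div_mul_cancel hp0.ne',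
          ENNReal.rpow_one]
    _ ≤ (D ^ p + 1) * B := by gcongr; exact le_self_add

end Final

/-! ### The theorem in Euclidean space -/

theorem corollary7p2 (n : ℕ) (p β : ℝ) (hp : 1 < p) (hβ : β < p - 1)
    (Ω₀ F : Set (EuclideanSpace ℝ (Fin n))) (hΩ₀ : IsOpen Ω₀)
    (hthick : (((n : ℝ) - p + β : ℝ) : EReal) < lowerAssouadDim Ω₀ᶜ)
    (hF : IsClosed F) (hFΩ₀ : F ⊆ closure Ω₀)
    (hthin : upperAssouadDim F < (((n : ℝ) - p + β : ℝ) : EReal)) :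
    HardyInequalityFor p β (Ω₀ \ F) (LipZero Ω₀) := by
  obtain ⟨_, ⟨t, ⟨-, hEt⟩, rfl⟩, ht⟩ := lt_sSup_iff.1 hthick
  obtain ⟨_, ⟨s, ⟨hs, hFs⟩, rfl⟩, hst⟩ := sInf_lt_iff.1 hthin
  rw [EReal.coe_lt_coe_iff] at ht hst
  -- From `0 ≤ s < n - p + β` and `β < p - 1`; it makes the space nontrivial.
  have hn : 0 < n := by
    have : (0 : ℝ) < n := by linarith
    exact_mod_cast this
  have : Nonempty (Fin n) := ⟨⟨0, hn⟩⟩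
  have hfin : (Module.finrank ℝ (EuclideanSpace ℝ (Fin n)) : ℝ) = n := by simp
  obtain ⟨C, hC0, hC⟩ := exists_hardy_rpow_union volume hp hβ hΩ₀.isClosed_compl hF hs
    (by rwa [hfin]) (by rwa [hfin]) hEt hFs
  refine ⟨C, hC0, fun u ⟨⟨K, hK⟩, hcomp, hsub⟩ ↦ ?_⟩
  have hsupp : tsupport (Ω₀.indicator u) = closure {x | x ∈ Ω₀ ∧ u x ≠ 0} := by
    rw [tsupport, Set.support_indicator]
    rfl
  have hset : (Ω₀ᶜ ∪ F)ᶜ = Ω₀ \ F := by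
    rw [Set.compl_union, compl_compl, Set.sdiff_eq]
  have hset' : (Ω₀ \ F)ᶜ = Ω₀ᶜ ∪ F := by rw [← hset, compl_compl]
  have hmain := hC (Ω₀.indicator u) K (hK.indicator_of_closure_subset hΩ₀ hsub)
    (by rw [HasCompactSupport, hsupp]; exact hcomp)
    (by rw [hsupp]; exact Set.disjoint_compl_right_iff_subset.2 hsub)
  have hmeas : MeasurableSet (Ω₀ \ F) := hΩ₀.measurableSet.diff hF.measurableSet
  rw [hset] at hmain
  rw [hset']
  refine le_trans (le_of_eq ?_) (hmain.trans_eq ?_)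
  · refine setLIntegral_congr_fun hmeas fun x hx ↦ ?_
    rw [Set.indicator_of_mem hx.1]
  · congr 1
    refine setLIntegral_congr_fun hmeas fun x hx ↦ ?_
    have h1 : Ω₀.indicator u =ᶠ[nhds x] u := by
      filter_upwards [hΩ₀.mem_nhds hx.1] with y hy
      exact Set.indicator_of_mem hy u
    have h2 : ‖gradient u x‖ₑ = ‖fderiv ℝ u x‖ₑ := by
      rw [gradient, ← ofReal_norm, LinearIsometryEquiv.norm_map, ofReal_norm]
    rw [h2, h1.fderiv_eq]
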